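/- Let $\alpha\neq\beta$ be real parameters and consider the discrete KdV equation (H1) $$(u_{0,0}-u_{1,1})(u_{1,0}-u_{0,1})+\beta-\alpha=0$$ for $u:\mathbb{Z}^2\to\mathbb{R}$, where $u_{i,j}=u(k+i,l+j)$ and $S_k,S_l$ are the unit forward shifts in $k$ and $l$. Functions below depend on $k,l,\alpha,\beta$ and finitely many of the values $u_{i,j}$. A pair $(F,G)$ is a conservation law if $(S_l-I)G+(S_k-I)F=0$ on solutions. It is trivial if $F=F_0-(S_l-I)f$ and $G=G_0+(S_k-I)f$, where $F_0,G_0$ vanish on solutions and $f$ is an arbitrary such function. It is on the horizontal line if $G$ depends only on the values $u_{n,0}$, and on the vertical line if $F$ depends only on the values $u_{0,n}$. Here $\ln x$ means $\ln|x|$. In the horizontal case solutions are required to have $u(k+1,l)\neq u(k-1,l)$ for all $k,l$, and in the vertical case $u(k,l+1)\neq u(k,l-1)$ for all $k,l$. A generator $Z=Q\,\partial_{u_{0,0}}+\xi\cdot\partial_{(\alpha,\beta)}$ acts on functions by its prolongation $\sum_{i,j}S_k^iS_l^j(Q)\,\partial_{u_{i,j}}+\xi\cdot\partial_{(\alpha,\beta)}$.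 The discrete Euler operator is $E(A)=\sum_{n,m}S_k^{-n}S_l^{-m}(\partial A/\partial u_{n,m})$. Horizontal line. Let $$X=\frac{k}{u_{1,0}-u_{-1,0}}\partial_{u_{0,0}}-\partial_\alpha,\quad X_0=\frac{1}{u_{1,0}-u_{-1,0}}\partial_{u_{0,0}},\quad X_n=[X,X_{n-1}],$$ let $Q_n$ be the characteristic of $X_n$ (its coefficient of $\partial_{u_{0,0}}$), and let $$F=\ln(u_{0,1}-u_{-1,0}),\quad G=-\ln(u_{1,0}-u_{-1,0}),\quad F_n=X^n(F),\quad G_n=X^n(G).$$ Then for every $n\ge 0$ the pair $(F_n,G_n)$ is a nontrivial conservation law on the horizontal line, and $$E(G_n)=(S_k-S_k^{-1})Q_n,\qquad Q_n\neq0,\qquad E(G_n)\neq 0$$ (for each $k,l,\alpha,\beta$, as functions of $u$). The laws are distinct: no nonzero finite real linear combination of the $(F_n,G_n)$, $n\ge0$, is trivial. Vertical line. Let $$Y=\frac{l}{u_{0,1}-u_{0,-1}}\partial_{u_{0,0}}-\partial_\beta,\quad Y_0=\frac{1}{u_{0,1}-u_{0,-1}}\partial_{u_{0,0}},\quad Y_n=[Y,Y_{n-1}],$$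 let $\bar Q_n$ be the characteristic of $Y_n$, and let $$\bar F=\ln(u_{0,1}-u_{0,-1}),\quad \bar G=-\ln(u_{1,0}-u_{0,-1}),\quad \bar F_n=Y^n(\bar F),\quad \bar G_n=Y^n(\bar G).$$ Then for every $n\ge 0$ the pair $(\bar F_n,\bar G_n)$ is a nontrivial conservation law on the vertical line, and $$E(\bar F_n)=-(S_l-S_l^{-1})\bar Q_n,\qquad \bar Q_n\neq0,\qquad E(\bar F_n)\neq 0$$ (for each $k,l,\alpha,\beta$, as functions of $u$). No nonzero finite real linear combination of the $(\bar F_n,\bar G_n)$, $n\ge0$, is trivial. -/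

import Mathlib

/-!
Lattice functions, the discrete KdV equation (H1), conservation laws and their triviality,
infinitesimal symmetries, and the discrete Euler operator.
-/

namespace DKdV

/-- A configuration: `u (i, j)` is the value `u_{i,j} = u(k+i, l+j)` relative to a base point
`(k, l)` of the lattice. -/
abbrev Config : Type := ℤ × ℤ → ℝ

/-- Functions `A(α, β, k, l, u)` of the parameters, the independent variables, and the values
of the dependent variable. -/
abbrev LatticeFun : Type := ℝ → ℝ → ℤ → ℤ → Config → ℝ

/-- `A` depends on the values of `u` at finitely many points only. -/
def IsLocal (A : LatticeFun) : Prop :=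
  ∃ s : Finset (ℤ × ℤ), ∀ (α β : ℝ) (k l : ℤ), DependsOn (A α β k l) (s : Set (ℤ × ℤ))

/-- The shift `S_k^i S_l^j` with `p = (i, j)`: it moves both the independent variables and the
values of `u`. -/
def shift (p : ℤ × ℤ) (A : LatticeFun) : LatticeFun :=
  fun α β k l u => A α β (k + p.1) (l + p.2) (fun q => u (q + p))

/-- The shift `S_k`. -/
def Sk (A : LatticeFun) : LatticeFun := shift (1, 0) A

/-- The shift `S_l`. -/
def Sl (A : LatticeFun) : LatticeFun := shift (0, 1) A

/-- The shift `S_k⁻¹`. -/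
def SkInv (A : LatticeFun) : LatticeFun := shift (-1, 0) A

/-- The shift `S_l⁻¹`. -/
def SlInv (A : LatticeFun) : LatticeFun := shift (0, -1) A

/-- The partial derivative `∂A/∂u_p`. -/
noncomputable def partialU (p : ℤ × ℤ) (A : LatticeFun) : LatticeFun :=
  fun α β k l u => deriv (fun t : ℝ => A α β k l (Function.update u p t)) (u p)

/-- The discrete Euler operator `E(A) = ∑_{n,m} S_k^{-n} S_l^{-m} (∂A/∂u_{n,m})`. The sum has
finitely many nonzero terms when `A` depends on finitely many values of `u`. -/
noncomputable def euler (A : LatticeFun) : LatticeFun :=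
  fun α β k l u => ∑ᶠ p : ℤ × ℤ, shift (-p) (partialU p A) α β k l u

/-- `u` solves `(u_{0,0} - u_{1,1})(u_{1,0} - u_{0,1}) + β - α = 0` on the whole lattice. -/
def IsSolution (α β : ℝ) (u : Config) : Prop :=
  ∀ p : ℤ × ℤ, (u p - u (p + (1, 1))) * (u (p + (1, 0)) - u (p + (0, 1))) + β - α = 0

/-- The configurations at which no `u_{i+1,j} - u_{i-1,j}` vanishes. -/
def HRegular : Set Config := {u | ∀ p : ℤ × ℤ, u (p + (1, 0)) ≠ u (p - (1, 0))}

/-- The configurations at which no `u_{i,j+1} - u_{i,j-1}` vanishes. -/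
def VRegular : Set Config := {u | ∀ p : ℤ × ℤ, u (p + (0, 1)) ≠ u (p - (0, 1))}

/-- `A` vanishes as a consequence of the equation with parameters `α, β`: it is zero at every
`(k, l)` on every solution in the domain `D` on which the functions considered are defined. -/
def VanishesOnSolutions (α β : ℝ) (D : Set Config) (A : LatticeFun) : Prop :=
  ∀ u ∈ D, IsSolution α β u → ∀ k l : ℤ, A α β k l u = 0

/-- `(F, G)` are the components of a conservation law `(S_l - I) G + (S_k - I) F = 0`. -/
def IsConservationLaw (α β : ℝ) (D : Set Config) (F G : LatticeFun) : Prop :=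
  IsLocal F ∧ IsLocal G ∧ VanishesOnSolutions α β D ((Sl G - G) + (Sk F - F))

/-- The law `(F, G)` is trivial: `F = F₀ - (S_l - I) f` and `G = G₀ + (S_k - I) f`, where `F₀`
and `G₀` vanish as a consequence of the equation and `f` is an arbitrary function of `k, l`,
the parameters, and finitely many values of `u`. -/
def IsTrivial (α β : ℝ) (D : Set Config) (F G : LatticeFun) : Prop :=
  ∃ f F₀ G₀ : LatticeFun, IsLocal f ∧ IsLocal F₀ ∧ IsLocal G₀ ∧
    VanishesOnSolutions α β D F₀ ∧ VanishesOnSolutions α β D G₀ ∧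
    F = F₀ - (Sl f - f) ∧ G = G₀ + (Sk f - f)

/-- A function that depends only on the values `u_{n,m}` with `m = 0`. -/
def OnHorizontalLine (A : LatticeFun) : Prop :=
  ∀ (α β : ℝ) (k l : ℤ), DependsOn (A α β k l) {p : ℤ × ℤ | p.2 = 0}

/-- A function that depends only on the values `u_{n,m}` with `n = 0`. -/
def OnVerticalLine (A : LatticeFun) : Prop :=
  ∀ (α β : ℝ) (k l : ℤ), DependsOn (A α β k l) {p : ℤ × ℤ | p.1 = 0}

/-- A generator `Q ∂/∂u_{0,0} + ξα ∂/∂α + ξβ ∂/∂β`. -/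
structure Generator where
  Q : LatticeFun
  ξα : ℝ → ℝ → ℝ
  ξβ : ℝ → ℝ → ℝ

/-- The action on functions of the prolonged generator
`∑_{i,j} S_k^i S_l^j(Q) ∂/∂u_{i,j} + ξα ∂/∂α + ξβ ∂/∂β`. -/
noncomputable def Generator.apply (X : Generator) (A : LatticeFun) : LatticeFun :=
  fun α β k l u =>
    (∑ᶠ p : ℤ × ℤ, shift p X.Q α β k l u * partialU p A α β k l u)
      + X.ξα α β * deriv (fun a : ℝ => A a β k l u) α
      + X.ξβ α β * deriv (fun b : ℝ => A α b k l u) β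

/-- The action of a generator on functions of the parameters alone. -/
noncomputable def Generator.applyParam (X : Generator) (ξ : ℝ → ℝ → ℝ) : ℝ → ℝ → ℝ :=
  fun α β => X.ξα α β * deriv (fun a : ℝ => ξ a β) α + X.ξβ α β * deriv (fun b : ℝ => ξ α b) β

/-- The commutator `[X, Y]` of two generators. -/
noncomputable def Generator.comm (X Y : Generator) : Generator where
  Q := X.apply Y.Q - Y.apply X.Q
  ξα := X.applyParam Y.ξα - Y.applyParam X.ξα
  ξβ := X.applyParam Y.ξβ - Y.applyParam X.ξβ

/-- `X = k / (u_{1,0} - u_{-1,0}) ∂/∂u_{0,0} - ∂/∂α`. -/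
noncomputable def X : Generator where
  Q := fun _ _ k _ u => (k : ℝ) / (u (1, 0) - u (-1, 0))
  ξα := fun _ _ => -1
  ξβ := fun _ _ => 0

/-- `X_0 = 1 / (u_{1,0} - u_{-1,0}) ∂/∂u_{0,0}` and `X_{n+1} = [X, X_n]`. -/
noncomputable def Xseq : ℕ → Generator
  | 0 =>
    { Q := fun _ _ _ _ u => 1 / (u (1, 0) - u (-1, 0))
      ξα := fun _ _ => 0
      ξβ := fun _ _ => 0 }
  | n + 1 => X.comm (Xseq n)

/-- `Y = l / (u_{0,1} - u_{0,-1}) ∂/∂u_{0,0} - ∂/∂β`. -/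
noncomputable def Y : Generator where
  Q := fun _ _ _ l u => (l : ℝ) / (u (0, 1) - u (0, -1))
  ξα := fun _ _ => 0
  ξβ := fun _ _ => -1

/-- `Y_0 = 1 / (u_{0,1} - u_{0,-1}) ∂/∂u_{0,0}` and `Y_{n+1} = [Y, Y_n]`. -/
noncomputable def Yseq : ℕ → Generator
  | 0 =>
    { Q := fun _ _ _ _ u => 1 / (u (0, 1) - u (0, -1))
      ξα := fun _ _ => 0
      ξβ := fun _ _ => 0 }
  | n + 1 => Y.comm (Yseq n)

/-- `F = ln(u_{0,1} - u_{-1,0})`; here and below `Real.log x` is `ln |x|`, the real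
antiderivative of `1 / x` on both half-lines. -/
noncomputable def F : LatticeFun := fun _ _ _ _ u => Real.log (u (0, 1) - u (-1, 0))

/-- `G = -ln(u_{1,0} - u_{-1,0})`. -/
noncomputable def G : LatticeFun := fun _ _ _ _ u => -Real.log (u (1, 0) - u (-1, 0))

/-- `F̄ = ln(u_{0,1} - u_{0,-1})`. -/
noncomputable def Fbar : LatticeFun := fun _ _ _ _ u => Real.log (u (0, 1) - u (0, -1))

/-- `Ḡ = -ln(u_{1,0} - u_{0,-1})`. -/
noncomputable def Gbar : LatticeFun := fun _ _ _ _ u => -Real.log (u (1, 0) - u (0, -1))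

/-- `F_n = X^n(F)`. -/
noncomputable def Fn (n : ℕ) : LatticeFun := X.apply^[n] F

/-- `G_n = X^n(G)`. -/
noncomputable def Gn (n : ℕ) : LatticeFun := X.apply^[n] G

/-- `F̄_n = Y^n(F̄)`. -/
noncomputable def Fbarn (n : ℕ) : LatticeFun := Y.apply^[n] Fbar

/-- `Ḡ_n = Y^n(Ḡ)`. -/
noncomputable def Gbarn (n : ℕ) : LatticeFun := Y.apply^[n] Gbar

end DKdV

/-!
The generators `X` and `Y`, the equation and all the functions involved are exchanged, up to sign,
by interchanging the two lattice directions and the two parameters, so only the horizontal line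
needs an argument. None of `F_n`, `G_n`, `Q_n` depends on the parameters, and away from the zeros of
the denominators each of them is a polynomial in the logarithms and reciprocals of differences of
values of `u`. On such polynomials, over formal variables, the vector fields `∑ v_p ∂/∂u_p` are
derivations (`der`), and `iterate_apply_eq_ev` identifies the iterates `X^n` with iterates of a
derivation. The rest of the proof is algebra in these polynomial rings, apart from the construction
of solutions for the nontriviality.

*Euler operator.* The commutator `[∂/∂u_p, X]` shows that `E(X A)` is `X(E(A))` plus the adjoint
linearization of the characteristic of `X` applied to `E(A)`. This is the recursion that defines
`(S_k - S_k⁻¹) Q_n`, whence `E(G_n) = (S_k - S_k⁻¹) Q_n` by induction (`eulerPoly_gPoly`). With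
`w_i = 1 / (u_{i+1,0} - u_{i-1,0})`, the characteristic `Q_n` is
`(-1)^n n! w_0² ⋯ w_{n-1}² w_n` plus a polynomial in the `w_i` with `i < n` (`qPoly_leading`). Hence
neither `Q_n` nor a nonzero linear combination of the `E(G_n)` vanishes identically.

*Conservation laws.* Modulo the ideal generated by the relations that define the reciprocals and by
the differences of the expressions `(u_p - u_{p+(1,1)}) (u_{p+(1,0)} - u_{p+(0,1)})`, each of these
expressions has derivative `-1` under `X`, just like `α - β` under `-∂/∂α`. So `X` preserves the
ideal (`planeDer_mem_eqIdeal`), which vanishes on solutions. For `n = 0` the law is the logarithm of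
an identity between differences, and its image under `X` lies in the ideal.

*Nontriviality.* For a trivial law, the sum of `G` along a row is a difference of values of a
potential at the two ends, and the sum of `F` along a column likewise. Adjacent rows of a solution
determine each other through the maps `y ↦ a - δ / (b - y)`, up to the choice of one value, and all
but countably many choices give a regular row. Hence two rows that differ at a single place extend
to two solutions that agree to the upper left and to the lower right of this place
(`exists_solutions`). Moving up from the left end and down from the right end of the row leads to
points where the potentials of the two solutions agree, so the sum of `G` along the row does not
change with the value at that place (`sum_row_eq_of_isTrivial`). Its derivative with respect to this
value is `E(G)`, which would have to vanish at every regular row.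
-/

namespace DKdV

open Function Filter Topology
open MvPolynomial hiding X

/-! ### Gradients of functions of a configuration -/

/-- `g` is the gradient of `a` at `u`: the finitely supported family of its partial derivatives. -/
def HasGrad (a : Config → ℝ) (u : Config) (g : (ℤ × ℤ) →₀ ℝ) : Prop :=
  ∀ p, HasDerivAt (fun t => a (update u p t)) (g p) (u p)

lemma hasGrad_const (c : ℝ) (u : Config) : HasGrad (fun _ => c) u 0 :=
  fun p => hasDerivAt_const (u p) c

lemma hasGrad_coord (q : ℤ × ℤ) (u : Config) :
    HasGrad (fun v => v q) u (Finsupp.single q 1) := by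
  intro p
  by_cases h : p = q
  · subst h
    simpa using hasDerivAt_id' (u p)
  · simpa [Finsupp.single_apply, Ne.symm h, update_of_ne (Ne.symm h)] using
      hasDerivAt_const (u p) (u q)

lemma HasGrad.add {a b : Config → ℝ} {u : Config} {g h : (ℤ × ℤ) →₀ ℝ}
    (ha : HasGrad a u g) (hb : HasGrad b u h) : HasGrad (fun v => a v + b v) u (g + h) :=
  fun p => (ha p).add (hb p)

lemma HasGrad.sub {a b : Config → ℝ} {u : Config} {g h : (ℤ × ℤ) →₀ ℝ}
    (ha : HasGrad a u g) (hb : HasGrad b u h) : HasGrad (fun v => a v - b v) u (g - h) :=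
  fun p => (ha p).sub (hb p)

lemma HasGrad.mul {a b : Config → ℝ} {u : Config} {g h : (ℤ × ℤ) →₀ ℝ}
    (ha : HasGrad a u g) (hb : HasGrad b u h) :
    HasGrad (fun v => a v * b v) u (b u • g + a u • h) := by
  intro p
  have := (ha p).mul (hb p)
  simp only [Pi.mul_def] at this
  refine this.congr_deriv ?_
  simp [mul_comm]

lemma HasGrad.comp {a : Config → ℝ} {u : Config} {g : (ℤ × ℤ) →₀ ℝ} {φ : ℝ → ℝ} {φ' : ℝ}
    (hφ : HasDerivAt φ φ' (a u)) (ha : HasGrad a u g) :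
    HasGrad (fun v => φ (a v)) u (φ' • g) := by
  intro p
  have h : HasDerivAt φ φ' (a (update u p (u p))) := by rwa [update_eq_self]
  exact h.comp (u p) (ha p)

/-- A set of configurations that is stable under small changes of any single value. -/
def UpdateOpen (U : Set Config) : Prop :=
  ∀ u ∈ U, ∀ p, ∀ᶠ t in 𝓝 (u p), update u p t ∈ U

lemma HasGrad.congr {U : Set Config} (hU : UpdateOpen U) {a b : Config → ℝ} {u : Config}
    {g : (ℤ × ℤ) →₀ ℝ} (ha : HasGrad a u g) (hu : u ∈ U) (h : ∀ v ∈ U, b v = a v) :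
    HasGrad b u g := by
  intro p
  refine (ha p).congr_of_eventuallyEq ?_
  filter_upwards [hU u hu p] with t ht using h _ ht

lemma HasGrad.partialU_eq {A : LatticeFun} {α β : ℝ} {k l : ℤ} {u : Config}
    {g : (ℤ × ℤ) →₀ ℝ} (h : HasGrad (A α β k l) u g) (p : ℤ × ℤ) :
    partialU p A α β k l u = g p :=
  (h p).deriv

lemma HasGrad.apply_eq {A : LatticeFun} {α β : ℝ} {k l : ℤ} {u : Config}
    {g : (ℤ × ℤ) →₀ ℝ} (h : HasGrad (A α β k l) u g)
    (hα : ∀ a, A a β k l u = A α β k l u) (hβ : ∀ b, A α b k l u = A α β k l u)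
    (Z : Generator) :
    Z.apply A α β k l u =
      Finsupp.linearCombination ℝ (fun p => shift p Z.Q α β k l u) g := by
  simp only [Generator.apply, hα, hβ, deriv_const, mul_zero, add_zero, h.partialU_eq]
  rw [finsum_eq_sum_of_support_subset (s := g.support), Finsupp.linearCombination_apply,
    Finsupp.sum]
  · exact Finset.sum_congr rfl fun p _ => by simp [mul_comm]
  · intro p hp
    simp only [mem_support] at hp
    simpa using right_ne_zero_of_mul hp

/-! ### Polynomials in the values of `u` and in logarithms and reciprocals of differences -/

/-- Formal variables: the values `u_p`, and for each index `i` of a family of pairs of lattice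
points the reciprocal and the logarithm of the difference of the two values of `u`. -/
inductive Var (I : Type) : Type
  | coord (p : ℤ × ℤ) : Var I
  | inv (i : I) : Var I
  | log (i : I) : Var I

/-- The polynomials in the formal variables. -/
abbrev Poly (I : Type) : Type := MvPolynomial (Var I) ℝ

variable {I : Type} (e : I → (ℤ × ℤ) × (ℤ × ℤ))

/-- The variable `u_p` as a polynomial. -/
noncomputable abbrev coordVar {I : Type} (p : ℤ × ℤ) : Poly I := MvPolynomial.X (.coord p)

/-- The reciprocal of the difference with index `i` as a polynomial. -/
noncomputable abbrev invVar {I : Type} (i : I) : Poly I := MvPolynomial.X (.inv i)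

/-- The logarithm of the difference with index `i` as a polynomial. -/
noncomputable abbrev logVar {I : Type} (i : I) : Poly I := MvPolynomial.X (.log i)

/-- The value at `u` of a formal variable, where `e i` is the pair of points with index `i`. -/
noncomputable def Var.val (u : Config) : Var I → ℝ
  | .coord p => u p
  | .inv i => (u (e i).1 - u (e i).2)⁻¹
  | .log i => Real.log (u (e i).1 - u (e i).2)

/-- The value of a formal polynomial at a configuration. -/
noncomputable def ev (u : Config) : Poly I →ₐ[ℝ] ℝ := aeval (Var.val e u)

/-- The configurations at which the reciprocals and logarithms are defined. -/
def Regular : Set Config := {u | ∀ i, u (e i).1 ≠ u (e i).2}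

/-- The formal counterpart of the vector field `∑_p v_p ∂/∂u_p`. -/
noncomputable def der (v : ℤ × ℤ → Poly I) : Derivation ℝ (Poly I) (Poly I) :=
  mkDerivation ℝ fun
    | .coord p => v p
    | .inv i => -invVar i ^ 2 * (v (e i).1 - v (e i).2)
    | .log i => invVar i * (v (e i).1 - v (e i).2)

@[simp] lemma der_coord (v : ℤ × ℤ → Poly I) (p : ℤ × ℤ) : der e v (coordVar p) = v p :=
  mkDerivation_X ..

@[simp] lemma der_inv (v : ℤ × ℤ → Poly I) (i : I) :
    der e v (invVar i) = -invVar i ^ 2 * (v (e i).1 - v (e i).2) :=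
  mkDerivation_X ..

@[simp] lemma der_log (v : ℤ × ℤ → Poly I) (i : I) :
    der e v (logVar i) = invVar i * (v (e i).1 - v (e i).2) :=
  mkDerivation_X ..

@[simp] lemma ev_C (u : Config) (c : ℝ) : ev e u (C c) = c := by
  simp [ev]

@[simp] lemma ev_coord (u : Config) (p : ℤ × ℤ) : ev e u (coordVar p) = u p := by
  simp [ev, Var.val]

@[simp] lemma ev_inv (u : Config) (i : I) :
    ev e u (invVar i) = (u (e i).1 - u (e i).2)⁻¹ := by
  simp [ev, Var.val]

@[simp] lemma ev_log (u : Config) (i : I) :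
    ev e u (logVar i) = Real.log (u (e i).1 - u (e i).2) := by
  simp [ev, Var.val]

/-- Formal and actual differentiation agree: the value of `der e v f` is the derivative of the
value of `f` in the direction given by the values of `v`. -/
lemma exists_hasGrad_ev {u : Config} (hu : u ∈ Regular e) (f : Poly I) :
    ∃ g, HasGrad (fun w => ev e w f) u g ∧
      ∀ (v : ℤ × ℤ → Poly I) (c : ℤ × ℤ → ℝ), (∀ p, ev e u (v p) = c p) →
        Finsupp.linearCombination ℝ c g = ev e u (der e v f) := by
  have hdiff (i : I) : HasGrad (fun w => w (e i).1 - w (e i).2) u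
      (Finsupp.single (e i).1 1 - Finsupp.single (e i).2 1) :=
    (hasGrad_coord _ u).sub (hasGrad_coord _ u)
  have hne (i : I) : u (e i).1 - u (e i).2 ≠ 0 := sub_ne_zero.2 (hu i)
  induction f using MvPolynomial.induction_on with
  | C c =>
    refine ⟨0, by simpa using hasGrad_const c u, fun v c hc => ?_⟩
    simp [← algebraMap_eq]
  | add f g hf hg =>
    obtain ⟨a, ha, ha'⟩ := hf
    obtain ⟨b, hb, hb'⟩ := hg
    refine ⟨a + b, by simpa using ha.add hb, fun v c hc => ?_⟩
    rw [map_add, map_add, map_add, ha' v c hc, hb' v c hc]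
  | mul_X f x hf =>
    obtain ⟨a, ha, ha'⟩ := hf
    have hx : ∃ g, HasGrad (fun w => ev e w (.X x)) u g ∧
        ∀ (v : ℤ × ℤ → Poly I) (c : ℤ × ℤ → ℝ), (∀ p, ev e u (v p) = c p) →
        Finsupp.linearCombination ℝ c g = ev e u (der e v (.X x)) := by
      cases x with
      | coord p => exact ⟨_, by simpa using hasGrad_coord p u, fun v c hc => by simp [hc]⟩
      | inv i =>
        refine ⟨_, by simpa using HasGrad.comp (hasDerivAt_inv (hne i)) (hdiff i),
          fun v c hc => ?_⟩
        simp [hc]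
      | log i =>
        refine ⟨_, by simpa using HasGrad.comp (Real.hasDerivAt_log (hne i)) (hdiff i),
          fun v c hc => ?_⟩
        simp [hc]
    obtain ⟨b, hb, hb'⟩ := hx
    refine ⟨_, by simpa using ha.mul hb, fun v c hc => ?_⟩
    simp only [map_add, map_smul, ha' v c hc, hb' v c hc, Derivation.leibniz, smul_eq_mul,
      map_mul]
    ring

lemma hasDerivAt_ev {u : Config} (hu : u ∈ Regular e) (f : Poly I) (p : ℤ × ℤ) :
    HasDerivAt (fun t => ev e (update u p t) f) (ev e u (der e (Pi.single p 1) f)) (u p) := by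
  obtain ⟨g, hg, hg'⟩ := exists_hasGrad_ev e hu f
  rw [← hg' (Pi.single p 1) (Pi.single p 1)]
  · convert hg p
    simp +contextual [Finsupp.linearCombination_apply, Finsupp.sum, Pi.single_apply, eq_comm]
  · intro q
    by_cases h : q = p
    · subst h; simp
    · simp [h]

lemma updateOpen_regular (he : ∀ p, {i | (e i).1 = p ∨ (e i).2 = p}.Finite) :
    UpdateOpen (Regular e) := by
  intro u hu p
  have h1 (i : I) : ∀ᶠ t in 𝓝 (u p), update u p t (e i).1 ≠ update u p t (e i).2 := by
    have hc (q : ℤ × ℤ) : ContinuousAt (fun t => update u p t q) (u p) :=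
      (hasGrad_coord q u p).continuousAt
    refine ((hc _).sub (hc _)).eventually_ne (y := 0) ?_ |>.mono fun t ht => sub_ne_zero.1 ht
    simpa [sub_eq_zero] using hu i
  have h2 : ∀ᶠ t in 𝓝 (u p), ∀ i ∈ {i | (e i).1 = p ∨ (e i).2 = p},
      update u p t (e i).1 ≠ update u p t (e i).2 :=
    (eventually_all_finite (he p)).2 fun i _ => h1 i
  filter_upwards [h2] with t ht i
  by_cases hi : (e i).1 = p ∨ (e i).2 = p
  · exact ht i hi
  · push Not at hi
    rw [update_of_ne hi.1, update_of_ne hi.2]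
    exact hu i

lemma der_smul (a : Poly I) (v : ℤ × ℤ → Poly I) : der e (a • v) = a • der e v := by
  refine MvPolynomial.derivation_ext fun x => ?_
  cases x <;> simp <;> ring

lemma der_add (v v' : ℤ × ℤ → Poly I) : der e (v + v') = der e v + der e v' := by
  refine MvPolynomial.derivation_ext fun x => ?_
  cases x <;> simp <;> ring

/-- The commutator of two vector fields is the vector field whose components are obtained by
letting each of them act on the components of the other. -/
lemma der_comm (v v' : ℤ × ℤ → Poly I) (f : Poly I) :
    der e v (der e v' f) =
      der e v' (der e v f) + der e (fun p => der e v (v' p) - der e v' (v p)) f := by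
  have h : ⁅der e v, der e v'⁆ = der e (fun p => der e v (v' p) - der e v' (v p)) := by
    refine MvPolynomial.derivation_ext fun x => ?_
    cases x <;> simp [Derivation.commutator_apply] <;> ring
  rw [← h, Derivation.commutator_apply]
  ring

/-- The component of `X` at `p`: the value of `S_k^i S_l^j` applied to its characteristic. -/
noncomputable def speed (k : ℤ) (u : Config) (p : ℤ × ℤ) : ℝ :=
  ((k + p.1 : ℤ) : ℝ) / (u (p + (1, 0)) - u (p - (1, 0)))

lemma shift_X_Q (p : ℤ × ℤ) (α β : ℝ) (k l : ℤ) (u : Config) :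
    shift p X.Q α β k l u = speed k u p := by
  simp only [shift, DKdV.X, speed]
  congr 3 <;> simp [add_comm, sub_eq_add_neg]

/-- If a function is given by a polynomial on the regular set, then applying `X` to it amounts
to applying the formal counterpart of `X` to the polynomial. -/
lemma iterate_apply_eq_ev (he : UpdateOpen (Regular e)) (v : ℤ → ℤ × ℤ → Poly I)
    (hv : ∀ k, ∀ u ∈ Regular e, ∀ p, ev e u (v k p) = speed k u p)
    {A : LatticeFun} {f : ℤ → Poly I}
    (hA : ∀ α β k l, ∀ u ∈ Regular e, A α β k l u = ev e u (f k)) (n : ℕ) :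
    ∀ α β k l, ∀ u ∈ Regular e,
      DKdV.X.apply^[n] A α β k l u = ev e u ((der e (v k))^[n] (f k)) := by
  induction n with
  | zero => exact hA
  | succ n ih =>
    intro α β k l u hu
    obtain ⟨g, hg, hg'⟩ := exists_hasGrad_ev e hu ((der e (v k))^[n] (f k))
    have hg2 := hg.congr he hu fun w hw => ih α β k l w hw
    rw [iterate_succ_apply', iterate_succ_apply', hg2.apply_eq _ _ DKdV.X]
    · exact hg' _ _ fun p => by rw [hv k u hu, shift_X_Q]
    · intro a; rw [ih _ _ _ _ _ hu, ih _ _ _ _ _ hu]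
    · intro a; rw [ih _ _ _ _ _ hu, ih _ _ _ _ _ hu]

/-! ### Translation of formal polynomials -/

/-- Translation of a formal variable by a lattice vector. -/
def Var.translate (r : ℤ × ℤ) : Var (ℤ × ℤ) → Var (ℤ × ℤ)
  | .coord p => .coord (p + r)
  | .inv p => .inv (p + r)
  | .log p => .log (p + r)

/-- Translation of formal polynomials by a lattice vector: the shift without its action on
the independent variables. -/
noncomputable def translate (r : ℤ × ℤ) : Poly (ℤ × ℤ) →ₐ[ℝ] Poly (ℤ × ℤ) :=
  rename (Var.translate r)

@[simp] lemma translate_C (r : ℤ × ℤ) (c : ℝ) : translate r (C c) = C c := by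
  simp [translate]

@[simp] lemma translate_coord (r p : ℤ × ℤ) : translate r (coordVar p) = coordVar (p + r) := by
  simp [translate, Var.translate]

@[simp] lemma translate_inv (r p : ℤ × ℤ) : translate r (invVar p) = invVar (p + r) := by
  simp [translate, Var.translate]

@[simp] lemma translate_log (r p : ℤ × ℤ) : translate r (logVar p) = logVar (p + r) := by
  simp [translate, Var.translate]

lemma translate_translate (r s : ℤ × ℤ) (f : Poly (ℤ × ℤ)) :
    translate r (translate s f) = translate (s + r) f := by
  simp only [translate, rename_rename]
  congr 2
  funext x
  cases x <;> simp [Var.translate, add_assoc]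

/-- The pair of horizontal neighbours of a lattice point. -/
def rowEnds (p : ℤ × ℤ) : (ℤ × ℤ) × (ℤ × ℤ) := (p + (1, 0), p - (1, 0))

lemma updateOpen_HRegular : UpdateOpen HRegular := by
  refine updateOpen_regular rowEnds fun p => ?_
  refine (Set.toFinite {p - (1, 0), p + (1, 0)}).subset ?_
  rintro i (rfl | rfl) <;> simp [rowEnds]

lemma ev_translate (r : ℤ × ℤ) (u : Config) (f : Poly (ℤ × ℤ)) :
    ev rowEnds u (translate r f) = ev rowEnds (fun q => u (q + r)) f := by
  simp only [translate, ev, aeval_rename]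
  congr 2
  funext x
  cases x <;> simp [Var.translate, Var.val, rowEnds, add_right_comm, add_sub_right_comm]

lemma der_translate {v v' : ℤ × ℤ → Poly (ℤ × ℤ)} {r : ℤ × ℤ}
    (h : ∀ p, v (p + r) = translate r (v' p)) (f : Poly (ℤ × ℤ)) :
    der rowEnds v (translate r f) = translate r (der rowEnds v' f) := by
  induction f using MvPolynomial.induction_on with
  | C c => simp [← algebraMap_eq]
  | add f g hf hg => simp only [map_add, hf, hg]
  | mul_X f x hf =>
    simp only [map_mul, Derivation.leibniz, hf, map_add, smul_eq_mul]
    congr 2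
    have h1 (p : ℤ × ℤ) : p + r + (1, 0) = p + (1, 0) + r := add_right_comm ..
    have h2 (p : ℤ × ℤ) : p + r - (1, 0) = p - (1, 0) + r := (sub_add_eq_add_sub ..).symm
    cases x <;> simp [rowEnds, h, h1, h2]

/-! ### The generators and the Euler operator on polynomials -/

/-- The components of `X` at `k` as polynomials. -/
noncomputable def rowVel (k : ℤ) (p : ℤ × ℤ) : Poly (ℤ × ℤ) := C ((k + p.1 : ℤ) : ℝ) * invVar p

/-- The action of `X` at `k` on polynomials. -/
noncomputable abbrev derX (k : ℤ) : Derivation ℝ (Poly (ℤ × ℤ)) (Poly (ℤ × ℤ)) :=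
  der rowEnds (rowVel k)

/-- The partial derivative `∂/∂u_p` on polynomials. -/
noncomputable abbrev derU (p : ℤ × ℤ) : Derivation ℝ (Poly (ℤ × ℤ)) (Poly (ℤ × ℤ)) :=
  der rowEnds (Pi.single p 1)

lemma ev_rowVel (k : ℤ) (u : Config) (p : ℤ × ℤ) :
    ev rowEnds u (rowVel k p) = speed k u p := by
  simp [rowVel, speed, rowEnds, div_eq_mul_inv]

lemma derX_translate (k : ℤ) (r : ℤ × ℤ) (f : Poly (ℤ × ℤ)) :
    derX k (translate r f) = translate r (derX (k + r.1) f) := by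
  refine der_translate (fun p => ?_) f
  simp only [rowVel, map_mul, translate_C, translate_inv, Prod.fst_add]
  congr 3
  ring

lemma derU_translate (p r : ℤ × ℤ) (f : Poly (ℤ × ℤ)) :
    derU p (translate r f) = translate r (derU (p - r) f) := by
  refine der_translate (fun q => ?_) f
  simp [Pi.single_apply, eq_sub_iff_add_eq, apply_ite (translate r)]

/-- The commutator of `∂/∂u_p` with `X`. -/
lemma derU_derX (k : ℤ) (p : ℤ × ℤ) (f : Poly (ℤ × ℤ)) :
    derU p (derX k f) = derX k (derU p f)
      + (C ((k + p.1 + 1 : ℤ) : ℝ) * invVar (p + (1, 0)) ^ 2 * derU (p + (1, 0)) f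
      - C ((k + p.1 - 1 : ℤ) : ℝ) * invVar (p - (1, 0)) ^ 2 * derU (p - (1, 0)) f) := by
  have h : (fun q => derU p (rowVel k q) - derX k ((Pi.single p 1 : ℤ × ℤ → Poly (ℤ × ℤ)) q)) =
      (C ((k + p.1 + 1 : ℤ) : ℝ) * invVar (p + (1, 0)) ^ 2) •
          (Pi.single (p + (1, 0)) 1 : ℤ × ℤ → Poly (ℤ × ℤ))
        + (-(C ((k + p.1 - 1 : ℤ) : ℝ) * invVar (p - (1, 0)) ^ 2)) •
          (Pi.single (p - (1, 0)) 1 : ℤ × ℤ → Poly (ℤ × ℤ)) := by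
    funext q
    have h0 : derX k ((Pi.single p 1 : ℤ × ℤ → Poly (ℤ × ℤ)) q) = 0 := by
      rw [Pi.single_apply]; split_ifs <;> simp
    have hC : derU p (C ((k + q.1 : ℤ) : ℝ)) = 0 := by rw [← algebraMap_eq]; simp
    rw [h0, rowVel, Derivation.leibniz, der_inv, hC]
    simp only [rowEnds, Pi.add_apply, Pi.smul_apply, Pi.single_apply, smul_eq_mul, mul_zero,
      add_zero, sub_zero]
    by_cases h1 : q = p + (1, 0)
    · subst h1
      have h2 : p + (1, 0) + (1, 0) ≠ p := by simp [Prod.ext_iff, add_assoc]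
      have h3 : p + (1, 0) ≠ p - (1, 0) := by simp [Prod.ext_iff, sub_eq_add_neg]
      simp only [h2, h3, if_false, add_sub_cancel_right, if_true, Prod.fst_add]
      simp only [add_assoc]
      ring
    · by_cases h4 : q = p - (1, 0)
      · subst h4
        have h2 : p - (1, 0) - (1, 0) ≠ p := by simp [Prod.ext_iff, sub_sub]
        simp only [h2, h1, if_false, sub_add_cancel, if_true, Prod.fst_sub]
        simp only [add_sub_assoc]
        ring
      · have h2 : q + (1, 0) ≠ p := fun h => h4 (by rw [← h]; simp)
        have h3 : q - (1, 0) ≠ p := fun h => h1 (by rw [← h]; simp)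
        simp [h1, h2, h3, h4]
  rw [derU, derX, der_comm, h, der_add, der_smul, der_smul]
  simp only [Derivation.add_apply, Derivation.smul_apply, smul_eq_mul]
  ring

/-- `G_n` at `k` as a polynomial. -/
noncomputable def gPoly (n : ℕ) (k : ℤ) : Poly (ℤ × ℤ) := (derX k)^[n] (-logVar 0)

lemma gPoly_succ (n : ℕ) (k : ℤ) : gPoly (n + 1) k = derX k (gPoly n k) :=
  iterate_succ_apply' ..

/-- The characteristic of `X_n` at `k` as a polynomial. -/
noncomputable def qPoly : ℕ → ℤ → Poly (ℤ × ℤ)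
  | 0, _ => invVar 0
  | n + 1, k => derX k (qPoly n k) + C (k : ℝ) * invVar 0 ^ 2 *
      (translate (1, 0) (qPoly n (k + 1)) - translate (-1, 0) (qPoly n (k - 1)))

/-- The Euler operator on families of polynomials depending on `k`. -/
noncomputable def eulerPoly (g : ℤ → Poly (ℤ × ℤ)) (k : ℤ) : Poly (ℤ × ℤ) :=
  ∑ᶠ p : ℤ × ℤ, translate (-p) (derU p (g (k + (-p).1)))

lemma derU_gPoly_eq_zero (n : ℕ) (k : ℤ) (p : ℤ × ℤ)
    (hp : ¬ (-(n + 1 : ℤ) ≤ p.1 ∧ p.1 ≤ n + 1 ∧ p.2 = 0)) : derU p (gPoly n k) = 0 := by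
  induction n generalizing k p with
  | zero =>
    have h1 : (0 : ℤ × ℤ) + (1, 0) ≠ p := by rintro rfl; simp at hp
    have h2 : (0 : ℤ × ℤ) - (1, 0) ≠ p := by rintro rfl; simp at hp
    simp [gPoly, rowEnds, -zero_add, -zero_sub, h1, h2]
  | succ n ih =>
    push_cast at hp
    rw [gPoly_succ, derU_derX, ih k p (by omega), ih k (p + (1, 0)), ih k (p - (1, 0))]
    · simp
    · simp only [Prod.fst_sub, Prod.snd_sub]
      omega
    · simp only [Prod.fst_add, Prod.snd_add]
      omega

lemma finite_support_translate_derU_gPoly (n : ℕ) (r : ℤ × ℤ → ℤ × ℤ)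
    (a : ℤ × ℤ → Poly (ℤ × ℤ)) (m : ℤ × ℤ → ℤ) (s : ℤ × ℤ) :
    (support fun p => a p * translate (r p) (derU (p + s) (gPoly n (m p)))).Finite := by
  refine ((Set.finite_Icc (-(n + 1 : ℤ), (0 : ℤ)) (n + 1, 0)).preimage
    (f := fun p => p + s) (add_left_injective s).injOn).subset ?_
  intro p hp
  by_contra h
  refine hp ?_
  simp only
  rw [derU_gPoly_eq_zero, map_zero, mul_zero]
  intro h'
  refine h ?_
  simp only [Set.mem_preimage, Set.mem_Icc, Prod.le_def]
  omega

/-- How the Euler operator changes under the action of `X`: besides `X` itself there appears the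
adjoint of the linearization of the characteristic of `X`. -/
lemma eulerPoly_gPoly_succ (n : ℕ) (k : ℤ) :
    eulerPoly (gPoly (n + 1)) k = derX k (eulerPoly (gPoly n) k)
      + (C ((k + 1 : ℤ) : ℝ) * invVar (1, 0) ^ 2 * translate (1, 0) (eulerPoly (gPoly n) (k + 1))
      - C ((k - 1 : ℤ) : ℝ) * invVar (-1, 0) ^ 2
        * translate (-1, 0) (eulerPoly (gPoly n) (k - 1))) := by
  have hs0 (k : ℤ) : (support fun p : ℤ × ℤ =>
      translate (-p) (derU p (gPoly n (k + (-p).1)))).Finite := by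
    simpa using finite_support_translate_derU_gPoly n (fun p => -p) (fun _ => 1)
      (fun p => k + (-p).1) 0
  -- reindexing the terms with a shifted partial derivative
  have hshift (c : Poly (ℤ × ℤ)) (s : ℤ × ℤ) :
      ∑ᶠ p : ℤ × ℤ, c * translate (-p) (derU (p + s) (gPoly n (k + (-p).1))) =
        c * translate s (eulerPoly (gPoly n) (k + s.1)) := by
    have h (p : ℤ × ℤ) : translate s (translate (-(p + s)) (derU (p + s)
        (gPoly n (k + s.1 + (-(p + s)).1)))) =
          translate (-p) (derU (p + s) (gPoly n (k + (-p).1))) := by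
      have h1 : -(p + s) + s = -p := by abel
      have h2 : k + s.1 + (-(p + s)).1 = k + (-p).1 := by
        simp only [Prod.fst_neg, Prod.fst_add]; ring
      rw [translate_translate, h1, h2]
    rw [eulerPoly, map_finsum _ (hs0 _), ← mul_finsum,
      ← finsum_comp_equiv (Equiv.addRight s) (f := fun p => translate s (translate (-p) _))]
    exact congrArg (c * ·) (finsum_congr fun p => (h p).symm)
  have hterm (p : ℤ × ℤ) : translate (-p) (derU p (gPoly (n + 1) (k + (-p).1))) =
      derX k (translate (-p) (derU p (gPoly n (k + (-p).1))))
      + (C ((k + 1 : ℤ) : ℝ) * invVar (1, 0) ^ 2 *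
          translate (-p) (derU (p + (1, 0)) (gPoly n (k + (-p).1)))
        + -(C ((k - 1 : ℤ) : ℝ) * invVar (-1, 0) ^ 2) *
          translate (-p) (derU (p + (-1, 0)) (gPoly n (k + (-p).1)))) := by
    have h1 : p + (1, 0) + -p = (1, 0) := by abel
    have h2 : p + (-1, 0) + -p = (-1, 0) := by abel
    have h3 : p - (1, 0) = p + (-1, 0) := by ext <;> simp [sub_eq_add_neg]
    have h4 : k + (-p).1 + p.1 = k := by simp
    rw [gPoly_succ, derU_derX, derX_translate]
    generalize gPoly n (k + (-p).1) = g
    rw [h3, h4]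
    simp only [map_add, map_sub, map_mul, map_pow, translate_C, translate_inv, h1, h2]
    ring
  rw [eulerPoly, finsum_congr hterm, finsum_add_distrib, finsum_add_distrib, hshift, hshift]
  · congr 1
    · rw [eulerPoly, map_finsum _ (hs0 k)]
    · simp only [← sub_eq_add_neg]
      ring
  · exact finite_support_translate_derU_gPoly ..
  · exact finite_support_translate_derU_gPoly ..
  · exact (hs0 k).subset (support_comp_subset (map_zero (derX k)) _)
  · refine Set.Finite.subset (Set.Finite.union ?_ ?_) (support_add _ _)
    · exact finite_support_translate_derU_gPoly ..
    · exact finite_support_translate_derU_gPoly ..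

/-- The formal version of `E(G_n) = (S_k - S_k⁻¹) Q_n`. -/
lemma eulerPoly_gPoly (n : ℕ) (k : ℤ) :
    eulerPoly (gPoly n) k =
      translate (1, 0) (qPoly n (k + 1)) - translate (-1, 0) (qPoly n (k - 1)) := by
  induction n generalizing k with
  | zero =>
    have h : ∀ p : ℤ × ℤ, translate (-p) (derU p (gPoly 0 (k + (-p).1))) =
        (Pi.single (1, 0) (-invVar (-1, 0)) : ℤ × ℤ → Poly (ℤ × ℤ)) p +
        (Pi.single (-1, 0) (invVar (1, 0)) : ℤ × ℤ → Poly (ℤ × ℤ)) p := by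
      intro p
      simp only [gPoly, iterate_zero, id, map_neg, der_log, rowEnds, Pi.single_apply]
      by_cases h1 : p = (1, 0)
      · subst h1; simp
      · by_cases h2 : p = (-1, 0)
        · subst h2; simp
        · simp [h1, h2, Ne.symm h1, Ne.symm h2]
    rw [eulerPoly, finsum_congr h, finsum_add_distrib, finsum_eq_single _ (1, 0),
      finsum_eq_single _ (-1, 0)]
    · simp [qPoly]; ring
    · intro p hp; simp [hp]
    · intro p hp; simp [hp]
    · exact (Set.finite_singleton _).subset Pi.support_single_subset
    · exact (Set.finite_singleton _).subset Pi.support_single_subset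
  | succ n ih =>
    rw [eulerPoly_gPoly_succ, ih, ih, ih, qPoly, qPoly]
    simp only [map_add, map_sub, map_mul, map_pow, translate_C, translate_inv, derX_translate,
      translate_translate, zero_add]
    ring_nf

/-! ### The polynomials represent the functions -/

lemma comp_add_mem_HRegular {u : Config} (hu : u ∈ HRegular) (r : ℤ × ℤ) :
    (fun q => u (q + r)) ∈ HRegular := by
  intro p
  have := hu (p + r)
  rwa [add_right_comm, add_sub_right_comm] at this

lemma Gn_eq_ev (n : ℕ) (α β : ℝ) (k l : ℤ) {u : Config} (hu : u ∈ HRegular) :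
    Gn n α β k l u = ev rowEnds u (gPoly n k) := by
  refine iterate_apply_eq_ev (A := G) (f := fun _ => -logVar 0) rowEnds updateOpen_HRegular rowVel
    (fun k u _ p => ev_rowVel k u p) ?_ n α β k l u hu
  intro α β k l u _
  simp [G, rowEnds]

/-- The action of a generator on the characteristic of `X`, which does not depend on the
parameters. -/
lemma apply_X_Q (Z : Generator) (α β : ℝ) (k l : ℤ) {u : Config} (hu : u ∈ HRegular) :
    Z.apply X.Q α β k l u = -(k : ℝ) * ((u (1, 0) - u (-1, 0))⁻¹) ^ 2 *
      (Sk Z.Q α β k l u - SkInv Z.Q α β k l u) := by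
  obtain ⟨g, hg, hg'⟩ := exists_hasGrad_ev rowEnds hu (C (k : ℝ) * invVar 0)
  have h : HasGrad (X.Q α β k l) u g := by
    refine hg.congr updateOpen_HRegular hu fun v _ => ?_
    simp [X, rowEnds, div_eq_mul_inv]
  rw [h.apply_eq (fun _ => rfl) (fun _ => rfl) Z,
    hg' (fun p => C (shift p Z.Q α β k l u)) _ fun p => by simp, Derivation.leibniz,
    ← algebraMap_eq, Derivation.map_algebraMap, der_inv]
  simp [rowEnds, Sk, SkInv]
  ring

lemma Xseq_Q_eq_ev (n : ℕ) (α β : ℝ) (k l : ℤ) {u : Config} (hu : u ∈ HRegular) :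
    (Xseq n).Q α β k l u = ev rowEnds u (qPoly n k) := by
  induction n generalizing α β k l u with
  | zero => simp [Xseq, qPoly, rowEnds]
  | succ n ih =>
    have h1 : X.apply (Xseq n).Q α β k l u = ev rowEnds u (derX k (qPoly n k)) :=
      iterate_apply_eq_ev rowEnds updateOpen_HRegular rowVel
        (fun k u _ p => ev_rowVel k u p) (fun α β k l u hu => ih α β k l hu) 1 α β k l u hu
    simp only [Xseq, Generator.comm, Pi.sub_apply, h1, qPoly, map_add,
      apply_X_Q (Xseq n) α β k l hu, Sk, SkInv, shift]
    rw [ih _ _ _ _ (comp_add_mem_HRegular hu _), ih _ _ _ _ (comp_add_mem_HRegular hu _)]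
    simp only [map_mul, map_sub, map_pow, ev_C, ev_inv, ev_translate, rowEnds, zero_add,
      zero_sub, Prod.neg_mk, neg_zero, ← sub_eq_add_neg]
    ring

lemma euler_Gn_eq_ev (n : ℕ) (α β : ℝ) (k l : ℤ) {u : Config} (hu : u ∈ HRegular) :
    euler (Gn n) α β k l u = ev rowEnds u (eulerPoly (gPoly n) k) := by
  have hfin : (support fun p : ℤ × ℤ =>
      translate (-p) (derU p (gPoly n (k + (-p).1)))).Finite := by
    simpa using finite_support_translate_derU_gPoly n (fun p => -p) (fun _ => 1)
      (fun p => k + (-p).1) 0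
  rw [eulerPoly, map_finsum _ hfin, euler]
  refine finsum_congr fun p => ?_
  rw [ev_translate, shift, partialU]
  have hu' := comp_add_mem_HRegular hu (-p)
  refine HasDerivAt.deriv ((hasDerivAt_ev rowEnds hu' _ p).congr_of_eventuallyEq ?_)
  filter_upwards [updateOpen_HRegular _ hu' p] with t ht using Gn_eq_ev n _ _ _ _ ht

lemma euler_Gn (n : ℕ) (α β : ℝ) (k l : ℤ) {u : Config} (hu : u ∈ HRegular) :
    euler (Gn n) α β k l u = Sk (Xseq n).Q α β k l u - SkInv (Xseq n).Q α β k l u := by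
  rw [euler_Gn_eq_ev n α β k l hu, eulerPoly_gPoly, Sk, SkInv, shift, shift,
    Xseq_Q_eq_ev _ _ _ _ _ (comp_add_mem_HRegular hu _),
    Xseq_Q_eq_ev _ _ _ _ _ (comp_add_mem_HRegular hu _), map_sub, ev_translate, ev_translate]
  rfl

/-! ### Leading terms -/

/-- The polynomials in the reciprocals `1 / (u_{i+1,0} - u_{i-1,0})` with `i < n`. -/
noncomputable def lower (n : ℤ) : Subalgebra ℝ (Poly (ℤ × ℤ)) :=
  Algebra.adjoin ℝ {f | ∃ i < n, f = invVar (i, 0)}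

lemma invVar_mem_lower {i n : ℤ} (h : i < n) : invVar (i, 0) ∈ lower n :=
  Algebra.subset_adjoin ⟨i, h, rfl⟩

lemma lower_mono {m n : ℤ} (h : m ≤ n) : lower m ≤ lower n := by
  refine Algebra.adjoin_mono ?_
  rintro f ⟨i, hi, rfl⟩
  exact ⟨i, by omega, rfl⟩

lemma C_mem_lower (c : ℝ) (n : ℤ) : C c ∈ lower n :=
  (lower n).algebraMap_mem c

lemma translate_mem_lower {f : Poly (ℤ × ℤ)} {n : ℤ} (hf : f ∈ lower n) (r : ℤ) :
    translate (r, 0) f ∈ lower (n + r) := by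
  refine Algebra.adjoin_induction (p := fun f _ => translate (r, 0) f ∈ lower (n + r))
    ?_ ?_ ?_ ?_ hf
  · rintro f ⟨i, hi, rfl⟩
    simpa using invVar_mem_lower (by omega)
  · intro c
    simpa using (lower (n + r)).algebraMap_mem c
  · intro f g _ _ hf hg
    simpa using add_mem hf hg
  · intro f g _ _ hf hg
    simpa using mul_mem hf hg

lemma derX_mem_lower {f : Poly (ℤ × ℤ)} {n : ℤ} (k : ℤ) (hf : f ∈ lower n) :
    derX k f ∈ lower (n + 1) := by
  have hmono : lower n ≤ lower (n + 1) := lower_mono (by omega)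
  refine Algebra.adjoin_induction (p := fun f _ => derX k f ∈ lower (n + 1)) ?_ ?_ ?_ ?_ hf
  · rintro f ⟨i, hi, rfl⟩
    rw [der_inv]
    refine mul_mem (neg_mem (pow_mem (invVar_mem_lower (by omega)) 2)) (sub_mem ?_ ?_)
    · exact mul_mem (C_mem_lower _ _) (by simpa [rowEnds] using invVar_mem_lower (by omega))
    · exact mul_mem (C_mem_lower _ _) (by simpa [rowEnds] using invVar_mem_lower (by omega))
  · intro c
    simp
  · intro f g _ _ hf hg
    simpa using add_mem hf hg
  · intro f g hf' hg' hf hg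
    rw [Derivation.leibniz, smul_eq_mul, smul_eq_mul]
    exact add_mem (mul_mem (hmono hf') hg) (mul_mem (hmono hg') hf)

/-- The product of the squares of `1 / (u_{i+1,0} - u_{i-1,0})` for `0 ≤ i < n`. -/
noncomputable def sqProd (n : ℕ) : Poly (ℤ × ℤ) :=
  ∏ i ∈ Finset.range n, invVar ((i : ℤ), 0) ^ 2

lemma sqProd_mem_lower (n : ℕ) : sqProd n ∈ lower n :=
  prod_mem fun i hi => pow_mem (invVar_mem_lower (by simpa using hi)) 2

/-- The leading term of the characteristic of `X_n`. -/
lemma qPoly_leading (n : ℕ) (k : ℤ) :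
    qPoly n k - C ((-1) ^ n * (n.factorial : ℝ)) * sqProd n * invVar ((n : ℤ), 0) ∈
      lower n := by
  have h0 : ((0 : ℤ), (0 : ℤ)) = 0 := rfl
  induction n generalizing k with
  | zero => simp [qPoly, sqProd, h0]
  | succ n ih =>
    obtain ⟨a, ha, h⟩ : ∃ a : ℤ → Poly (ℤ × ℤ), (∀ k, a k ∈ lower n) ∧ ∀ k, qPoly n k =
        C ((-1) ^ n * (n.factorial : ℝ)) * sqProd n * invVar ((n : ℤ), 0) + a k :=
      ⟨fun k => _, ih, fun k => (add_sub_cancel _ _).symm⟩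
    have hq (k : ℤ) : qPoly n k ∈ lower (n + 1) := by
      have hm : lower (n : ℤ) ≤ lower (n + 1) := lower_mono (by omega)
      rw [h]
      exact add_mem (mul_mem (mul_mem (C_mem_lower _ _) (hm (sqProd_mem_lower n)))
        (invVar_mem_lower (by omega))) (hm (ha k))
    have ht : translate (1, 0) (sqProd n) * invVar 0 ^ 2 = sqProd (n + 1) := by
      rw [sqProd, sqProd, Finset.prod_range_succ']
      simp [map_prod, h0]
    have hn : sqProd (n + 1) = sqProd n * invVar ((n : ℤ), 0) ^ 2 := Finset.prod_range_succ ..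
    set c : ℝ := (-1) ^ n * (n.factorial : ℝ) with hc
    have hC : (C ((-1) ^ (n + 1) * ((n + 1).factorial : ℝ)) : Poly (ℤ × ℤ)) =
        C (k : ℝ) * C c - C ((k + (n + 1) : ℤ) : ℝ) * C c := by
      rw [← C_mul, ← C_mul, ← C_sub, hc, Nat.factorial_succ]
      push_cast
      ring_nf
    have key : qPoly (n + 1) k - C ((-1) ^ (n + 1) * ((n + 1).factorial : ℝ)) * sqProd (n + 1) *
          invVar (((n + 1 : ℕ) : ℤ), 0) =
        derX k (a k)
          + C c * invVar ((n : ℤ), 0) * derX k (sqProd n)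
          + C ((k + (n - 1) : ℤ) : ℝ) * C c * sqProd n * invVar ((n : ℤ), 0) ^ 2 *
            invVar ((n : ℤ) - 1, 0)
          + C (k : ℝ) * invVar (0, 0) ^ 2 * (translate (1, 0) (a (k + 1))
            - translate (-1, 0) (qPoly n (k - 1))) := by
      rw [qPoly, h k, h (k + 1), hC, h0, hn]
      rw [hn] at ht
      have hDC : derX k (C c) = 0 := by rw [← algebraMap_eq]; simp
      simp only [map_add, map_mul, translate_C, translate_inv, Derivation.leibniz, hDC, der_inv,
        smul_eq_mul, rowEnds, rowVel, Prod.mk_add_mk, Prod.mk_sub_mk, add_zero, sub_zero,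
        Nat.cast_add, Nat.cast_one]
      linear_combination C (k : ℝ) * C c * invVar ((n : ℤ) + 1, 0) * ht
    rw [key]
    push_cast
    have hm : lower (n : ℤ) ≤ lower (n + 1) := lower_mono (by omega)
    have h00 : invVar (0, 0) ∈ lower ((n : ℤ) + 1) := invVar_mem_lower (by omega)
    have hnn : invVar ((n : ℤ), 0) ∈ lower ((n : ℤ) + 1) := invVar_mem_lower (by omega)
    refine add_mem (add_mem (add_mem (derX_mem_lower k (ha k)) ?_) ?_) ?_
    · exact mul_mem (mul_mem (C_mem_lower _ _) hnn) (derX_mem_lower k (sqProd_mem_lower n))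
    · exact mul_mem (mul_mem (mul_mem (mul_mem (C_mem_lower _ _) (C_mem_lower _ _))
        (hm (sqProd_mem_lower n))) (pow_mem hnn 2)) (invVar_mem_lower (by omega))
    · refine mul_mem (mul_mem (C_mem_lower _ _) (pow_mem h00 2)) (sub_mem ?_ ?_)
      · exact translate_mem_lower (ha (k + 1)) 1
      · exact lower_mono (by omega) (translate_mem_lower (hq (k - 1)) (-1))

lemma qPoly_mem_lower (n : ℕ) (k : ℤ) : qPoly n k ∈ lower (n + 1) := by
  have h := qPoly_leading n k
  have hm : lower (n : ℤ) ≤ lower (n + 1) := lower_mono (by omega)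
  have h' := add_mem (hm h) (mul_mem (mul_mem (C_mem_lower ((-1) ^ n * (n.factorial : ℝ)) (n + 1))
    (hm (sqProd_mem_lower n))) (invVar_mem_lower (i := (n : ℤ)) (by omega)))
  rwa [sub_add_cancel] at h'

/-- The leading term of the Euler operator applied to `G_n`. -/
lemma eulerPoly_leading (n : ℕ) (k : ℤ) :
    eulerPoly (gPoly n) k - C ((-1) ^ n * (n.factorial : ℝ)) * translate (1, 0) (sqProd n) *
      invVar ((n : ℤ) + 1, 0) ∈ lower (n + 1) := by
  have h := translate_mem_lower (qPoly_leading n (k + 1)) 1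
  have h' := lower_mono (by omega) (translate_mem_lower (qPoly_mem_lower n (k - 1)) (-1))
    (n := (n : ℤ) + 1)
  rw [eulerPoly_gPoly]
  convert sub_mem h h' using 1
  simp
  ring

/-- Polynomials with a nonvanishing leading term do not vanish identically. -/
lemma exists_ev_ne_zero {f a : Poly (ℤ × ℤ)} {n : ℤ} (ha : a ∈ lower n)
    (hf : f - a * invVar (n, 0) ∈ lower n) (ha0 : ev rowEnds (fun p => (p.1 : ℝ)) a ≠ 0) :
    ∃ u ∈ HRegular, ev rowEnds u f ≠ 0 := by
  -- changing `u_{n+1,0}` changes the value of the variable with index `n`, but of none below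
  let U (t : ℝ) : Config := update (fun p => (p.1 : ℝ)) (n + 1, 0) t
  have hlow (t : ℝ) {b : Poly (ℤ × ℤ)} (hb : b ∈ lower n) :
      ev rowEnds (U t) b = ev rowEnds (fun p => (p.1 : ℝ)) b := by
    refine Algebra.adjoin_induction
      (p := fun b _ => ev rowEnds (U t) b = ev rowEnds (fun p => (p.1 : ℝ)) b) ?_ ?_ ?_ ?_ hb
    · rintro b ⟨i, hi, rfl⟩
      have h1 : (i + 1, (0 : ℤ)) ≠ (n + 1, 0) := by simp; omega
      have h2 : (i - 1, (0 : ℤ)) ≠ (n + 1, 0) := by simp; omega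
      simp [U, rowEnds, h1, h2]
    · intro c; simp
    · intro b c _ _ hb hc; simp [hb, hc]
    · intro b c _ _ hb hc; simp [hb, hc]
  have hval (t : ℝ) : ev rowEnds (U t) f =
      ev rowEnds (fun p => (p.1 : ℝ)) (f - a * invVar (n, 0)) +
        ev rowEnds (fun p => (p.1 : ℝ)) a * (t - (n - 1))⁻¹ := by
    have h2 : (n - 1, (0 : ℤ)) ≠ (n + 1, 0) := by simp; omega
    rw [← hlow t hf, ← hlow t ha, map_sub, map_mul, ev_inv]
    simp [U, rowEnds, h2]
  have hreg (t : ℝ) (h1 : t ≠ n - 1) (h2 : t ≠ n + 3) : U t ∈ HRegular := by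
    intro p
    simp only [U, update_apply]
    split_ifs with h3 h4 h4
    · have := congrArg Prod.fst (h3.trans h4.symm)
      simp only [Prod.fst_add, Prod.fst_sub] at this
      omega
    · have := congrArg Prod.fst h3
      simp only [Prod.fst_add, Prod.fst_sub] at this ⊢
      rw [show p.1 = n by omega]
      exact_mod_cast h1
    · have := congrArg Prod.fst h4
      simp only [Prod.fst_add, Prod.fst_sub] at this ⊢
      rw [show p.1 = n + 2 by omega]
      push_cast
      intro h; apply h2; linarith
    · simp only [Prod.fst_add, Prod.fst_sub]
      push_cast
      intro h; linarith
  by_contra! hcon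
  have e1 := hcon _ (hreg (n : ℝ) (by intro h; linarith) (by intro h; linarith))
  have e2 := hcon _ (hreg ((n : ℝ) + 1) (by intro h; linarith) (by intro h; linarith))
  rw [hval] at e1 e2
  ring_nf at e1 e2
  apply ha0
  linarith

lemma ev_sqProd_ne_zero (n : ℕ) : ev rowEnds (fun p => (p.1 : ℝ)) (sqProd n) ≠ 0 := by
  rw [sqProd, map_prod, Finset.prod_ne_zero_iff]
  intro i _
  simp only [map_pow, ev_inv, rowEnds]
  refine pow_ne_zero _ (inv_ne_zero ?_)
  simp

lemma ev_translate_sqProd_ne_zero (n : ℕ) :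
    ev rowEnds (fun p => (p.1 : ℝ)) (translate (1, 0) (sqProd n)) ≠ 0 := by
  rw [sqProd, map_prod, map_prod, Finset.prod_ne_zero_iff]
  intro i _
  simp only [map_pow, translate_inv, ev_inv, rowEnds]
  refine pow_ne_zero _ (inv_ne_zero ?_)
  simp
  ring_nf
  norm_num

lemma leadingCoeff_ne_zero (n : ℕ) : (-1 : ℝ) ^ n * (n.factorial : ℝ) ≠ 0 :=
  mul_ne_zero (pow_ne_zero _ (by norm_num)) (by exact_mod_cast n.factorial_ne_zero)

lemma exists_Xseq_Q_ne_zero (n : ℕ) (α β : ℝ) (k l : ℤ) :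
    ∃ u ∈ HRegular, (Xseq n).Q α β k l u ≠ 0 := by
  obtain ⟨u, hu, h⟩ := exists_ev_ne_zero
    (mul_mem (C_mem_lower _ _) (sqProd_mem_lower n)) (qPoly_leading n k)
    (by simpa using ⟨n.factorial_ne_zero, ev_sqProd_ne_zero n⟩)
  exact ⟨u, hu, by rwa [Xseq_Q_eq_ev n α β k l hu]⟩

/-- Distinct Euler derivatives `E(G_n)` have distinct leading terms, so that no nontrivial linear
combination of them vanishes identically. -/
lemma exists_sum_euler_ne_zero {c : ℕ →₀ ℝ} (hc : c ≠ 0) (k : ℤ) :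
    ∃ u ∈ HRegular, ev rowEnds u (c.sum fun n a => C a * eulerPoly (gPoly n) k) ≠ 0 := by
  have hne : c.support.Nonempty := Finsupp.support_nonempty_iff.2 hc
  set N := c.support.max' hne with hN
  have hNmem : N ∈ c.support := Finset.max'_mem _ _
  refine exists_ev_ne_zero (n := (N : ℤ) + 1)
    (a := C (c N * ((-1) ^ N * (N.factorial : ℝ))) * translate (1, 0) (sqProd N)) ?_ ?_ ?_
  · exact mul_mem (C_mem_lower _ _) (translate_mem_lower (sqProd_mem_lower N) 1)
  · rw [Finsupp.sum, ← Finset.add_sum_erase _ _ hNmem]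
    have h1 : ∑ n ∈ c.support.erase N, C (c n) * eulerPoly (gPoly n) k ∈ lower ((N : ℤ) + 1) := by
      refine sum_mem fun n hn => mul_mem (C_mem_lower _ _) ?_
      have hlt : n < N := lt_of_le_of_ne
        (Finset.le_max' _ _ (Finset.mem_of_mem_erase hn)) (Finset.ne_of_mem_erase hn)
      rw [eulerPoly_gPoly]
      refine sub_mem ?_ ?_
      · exact lower_mono (by omega) (translate_mem_lower (qPoly_mem_lower n (k + 1)) 1)
      · exact lower_mono (by omega) (translate_mem_lower (qPoly_mem_lower n (k - 1)) (-1))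
    have h2 := mul_mem (C_mem_lower (c N) _) (eulerPoly_leading N k)
    convert add_mem h2 h1 using 1
    rw [C_mul]
    ring
  · rw [map_mul, ev_C]
    exact mul_ne_zero (mul_ne_zero (by simpa using hNmem) (leadingCoeff_ne_zero N))
      (ev_translate_sqProd_ne_zero N)

lemma exists_euler_Gn_ne_zero (n : ℕ) (α β : ℝ) (k l : ℤ) :
    ∃ u ∈ HRegular, euler (Gn n) α β k l u ≠ 0 := by
  obtain ⟨u, hu, h⟩ := exists_sum_euler_ne_zero (c := Finsupp.single n 1) (by simp) k
  exact ⟨u, hu, by simpa [euler_Gn_eq_ev n α β k l hu] using h⟩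

/-! ### Shifts commute with generators -/

lemma update_comp_add (u : Config) (p q : ℤ × ℤ) (t : ℝ) :
    (fun r => update u q t (r + p)) = update (fun r => u (r + p)) (q - p) t := by
  funext r
  simp only [update_apply, eq_sub_iff_add_eq]

lemma partialU_shift (p q : ℤ × ℤ) (A : LatticeFun) :
    partialU q (shift p A) = shift p (partialU (q - p) A) := by
  funext α β k l u
  simp only [partialU, shift, update_comp_add, sub_add_cancel]

/-- Prolongations commute with shifts. -/
lemma apply_shift (Z : Generator) (p : ℤ × ℤ) (A : LatticeFun) :
    Z.apply (shift p A) = shift p (Z.apply A) := by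
  funext α β k l u
  simp only [Generator.apply, partialU_shift, shift]
  congr 2
  rw [← finsum_comp_equiv (Equiv.addRight p)]
  refine finsum_congr fun q => ?_
  simp only [Equiv.coe_addRight, add_sub_cancel_right, Prod.fst_add, Prod.snd_add]
  congr 2
  · ring
  · ring
  · funext r; rw [add_assoc]

lemma iterate_apply_shift (Z : Generator) (p : ℤ × ℤ) (A : LatticeFun) (n : ℕ) :
    Z.apply^[n] (shift p A) = shift p (Z.apply^[n] A) := by
  induction n with
  | zero => rfl
  | succ n ih => rw [iterate_succ_apply', iterate_succ_apply', ih, apply_shift]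

/-! ### The ideal of the equation -/

/-- The pairs of points that enter `G` (left) and `F` (right). -/
def planeEnds : (ℤ × ℤ) ⊕ (ℤ × ℤ) → (ℤ × ℤ) × (ℤ × ℤ) :=
  Sum.elim rowEnds fun p => (p + (0, 1), p - (1, 0))

/-- Polynomials that represent the `F_n` as well as the `G_n`. -/
abbrev PlanePoly : Type := Poly ((ℤ × ℤ) ⊕ (ℤ × ℤ))

/-- The components of `X` at `k` as polynomials. -/
noncomputable def planeVel (k : ℤ) (p : ℤ × ℤ) : PlanePoly :=
  C ((k + p.1 : ℤ) : ℝ) * invVar (.inl p)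

/-- The action of `X` at `k` on polynomials. -/
noncomputable abbrev planeDer (k : ℤ) : Derivation ℝ PlanePoly PlanePoly :=
  der planeEnds (planeVel k)

lemma updateOpen_planeEnds : UpdateOpen (Regular planeEnds) := by
  refine updateOpen_regular planeEnds fun p => ?_
  refine (Set.toFinite {.inl (p - (1, 0)), .inl (p + (1, 0)), .inr (p - (0, 1)),
    .inr (p + (1, 0))}).subset ?_
  rintro (i | i) (rfl | rfl) <;> simp [planeEnds, rowEnds]

lemma iterate_X_apply_eq_ev {A : LatticeFun} {f : PlanePoly}
    (hA : ∀ α β k l, ∀ u ∈ Regular planeEnds, A α β k l u = ev planeEnds u f) (n : ℕ)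
    (α β : ℝ) (k l : ℤ) {u : Config} (hu : u ∈ Regular planeEnds) :
    X.apply^[n] A α β k l u = ev planeEnds u ((planeDer k)^[n] f) := by
  refine iterate_apply_eq_ev planeEnds updateOpen_planeEnds planeVel ?_ (f := fun _ => f) hA n
    α β k l u hu
  intro k u _ p
  simp [planeVel, speed, planeEnds, rowEnds, div_eq_mul_inv]

/-- The difference of the two values of `u` with index `i`. -/
noncomputable def diffPoly (i : (ℤ × ℤ) ⊕ (ℤ × ℤ)) : PlanePoly :=
  coordVar (planeEnds i).1 - coordVar (planeEnds i).2

/-- The product of the differences along the diagonals of an elementary square; the equation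
says that all of these equal `α - β`. -/
noncomputable def quad (p : ℤ × ℤ) : PlanePoly :=
  (coordVar p - coordVar (p + (1, 1))) * (coordVar (p + (1, 0)) - coordVar (p + (0, 1)))

/-- The ideal of relations among the formal variables that hold on solutions. The parameters
do not occur in it: the equation enters through the fact that `quad` is constant. -/
noncomputable def eqIdeal : Ideal PlanePoly :=
  Ideal.span ({f | ∃ i, f = invVar i * diffPoly i - 1} ∪ {f | ∃ p q, f = quad p - quad q})

lemma inv_mul_diff_sub_one_mem (i : (ℤ × ℤ) ⊕ (ℤ × ℤ)) :
    invVar i * diffPoly i - 1 ∈ eqIdeal :=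
  Ideal.subset_span (.inl ⟨i, rfl⟩)

lemma quad_sub_quad_mem (p q : ℤ × ℤ) : quad p - quad q ∈ eqIdeal :=
  Ideal.subset_span (.inr ⟨p, q, rfl⟩)

lemma ev_eq_zero_of_mem_eqIdeal {α β : ℝ} {u : Config} (hu : u ∈ Regular planeEnds)
    (hsol : IsSolution α β u) {f : PlanePoly} (hf : f ∈ eqIdeal) : ev planeEnds u f = 0 := by
  have h : eqIdeal ≤ RingHom.ker (ev planeEnds u) := by
    refine Ideal.span_le.2 ?_
    rintro f (⟨i, rfl⟩ | ⟨p, q, rfl⟩)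
    · have : u (planeEnds i).1 - u (planeEnds i).2 ≠ 0 := sub_ne_zero.2 (hu i)
      simp [RingHom.mem_ker, diffPoly, this]
    · have hp := hsol p
      have hq := hsol q
      simp only [SetLike.mem_coe, RingHom.mem_ker, quad, map_sub, map_mul, ev_coord]
      linarith
  exact h hf

/-- Modulo the relations, `X` acts on the elementary squares as on `α - β`. -/
lemma der_quad_ring {R : Type*} [CommRing R] {a b c d a' b' c' d' w₀ w₁ w₀' w₁' k : R}
    (h₀ : w₀ * (c - a) = 1) (h₁ : w₁ * (d - b) = 1) (h₀' : w₀' * (c' - a') = 1)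
    (h₁' : w₁' * (d' - b') = 1) (hr : (b - c') * (c - b') = (c - d') * (d - c'))
    (hl : (b - c') * (c - b') = (a - b') * (b - a')) :
    (b - c') * ((k + 1) * w₁ - k * w₀') + (c - b') * (k * w₀ - (k + 1) * w₁') = -1 := by
  have e₁ : w₁' * (c - b') = w₁ * (d - c') := by
    linear_combination (-w₁' * (c - b')) * h₁ + w₁ * (d - c') * h₁' - w₁ * w₁' * hr
  have e₀ : w₀' * (c' - b) = w₀ * (b' - a) := by
    linear_combination (-w₀' * (c' - b)) * h₀ + w₀ * (b' - a) * h₀' - w₀ * w₀' * hl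
  linear_combination -(k + 1) * e₁ + k * e₀ + k * h₀ - (k + 1) * h₁

/-- The differentiated form of the relation `(c - a) (c' - b) = (c' - a') (b' - a)`. -/
lemma der_log_ring {R : Type*} [CommRing R] {A B A' B' w z w' z' a b a' b' : R}
    (hA : w * A = 1) (hB : z * B = 1) (hA' : w' * A' = 1) (hB' : z' * B' = 1)
    (h : A * B = A' * B') (hd : a * B + A * b = a' * B' + A' * b') :
    w * a + z * b = w' * a' + z' * b' := by
  have e : w * z = w' * z' := by
    linear_combination (-w * z * w' * A') * hB' - w * z * hA' - w * z * w' * z' * h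
      + w' * z' * hA + w' * z' * w * A * hB
  linear_combination -w * a * hB - z * b * hA + w' * a' * hB' + z' * b' * hA' + w * z * hd
    + (a' * B' + A' * b') * e

lemma planeDer_quad_add_one_mem (k : ℤ) (p : ℤ × ℤ) : planeDer k (quad p) + 1 ∈ eqIdeal := by
  rw [← Ideal.Quotient.eq_zero_iff_mem]
  have hinv (i) : Ideal.Quotient.mk eqIdeal (invVar i) * Ideal.Quotient.mk eqIdeal (diffPoly i)
      = 1 := by
    have := Ideal.Quotient.eq_zero_iff_mem.2 (inv_mul_diff_sub_one_mem i)
    rwa [map_sub, map_mul, map_one, sub_eq_zero] at this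
  have hq (q) : Ideal.Quotient.mk eqIdeal (quad p) = Ideal.Quotient.mk eqIdeal (quad q) :=
    Ideal.Quotient.eq.2 (quad_sub_quad_mem p q)
  obtain ⟨i, j⟩ := p
  have h₀ := hinv (.inl (i, j))
  have h₁ := hinv (.inl (i + 1, j))
  have h₀' := hinv (.inl (i, j + 1))
  have h₁' := hinv (.inl (i + 1, j + 1))
  have hr := hq (i + 1, j)
  have hl := hq (i - 1, j)
  simp only [diffPoly, planeEnds, Sum.elim_inl, rowEnds, quad, map_sub, map_mul, Prod.mk_add_mk,
    Prod.mk_sub_mk, add_zero, sub_zero, add_sub_cancel_right, sub_add_cancel]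
    at h₀ h₁ h₀' h₁' hr hl
  have hk : (C ((k + (i + 1) : ℤ) : ℝ) : PlanePoly) = C ((k + i : ℤ) : ℝ) + 1 := by
    rw [← C_1, ← C_add]
    push_cast
    ring_nf
  have key := der_quad_ring (k := Ideal.Quotient.mk eqIdeal (C ((k + i : ℤ) : ℝ)))
    h₀ h₁ h₀' h₁' hr hl
  simp only [quad, Derivation.leibniz, map_sub, der_coord, planeVel, smul_eq_mul, map_add,
    map_mul, Prod.mk_add_mk, add_zero, hk, map_one]
  rw [key]
  ring

lemma planeDer_mem_eqIdeal (k : ℤ) {f : PlanePoly} (hf : f ∈ eqIdeal) :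
    planeDer k f ∈ eqIdeal := by
  induction hf using Submodule.span_induction with
  | mem f hf =>
    obtain ⟨i, rfl⟩ | ⟨p, q, rfl⟩ := hf
    · have : planeDer k (invVar i * diffPoly i - 1) =
          -(invVar i * (planeVel k (planeEnds i).1 - planeVel k (planeEnds i).2)) *
            (invVar i * diffPoly i - 1) := by
        simp only [diffPoly, map_sub, Derivation.leibniz, der_coord, der_inv, smul_eq_mul,
          Derivation.map_one_eq_zero]
        ring
      rw [this]
      exact Ideal.mul_mem_left _ _ (inv_mul_diff_sub_one_mem i)
    · have := sub_mem (planeDer_quad_add_one_mem k p) (planeDer_quad_add_one_mem k q)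
      rwa [add_sub_add_right_eq_sub, ← map_sub] at this
  | zero => simp
  | add f g _ _ hf hg => rw [map_add]; exact add_mem hf hg
  | smul a f hf' hf =>
    rw [smul_eq_mul, Derivation.leibniz, smul_eq_mul, smul_eq_mul]
    exact add_mem (Ideal.mul_mem_left _ _ hf) (Ideal.mul_mem_right _ _ hf')

/-- The logarithmic polynomial `(S_l - I) G + (S_k - I) F`. -/
noncomputable def lawPoly : PlanePoly :=
  (-logVar (.inl (0, 1)) - -logVar (.inl 0)) + (logVar (.inr (1, 0)) - logVar (.inr 0))

lemma planeDer_lawPoly_mem (k : ℤ) : planeDer k lawPoly ∈ eqIdeal := by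
  have hinv (i) : Ideal.Quotient.mk eqIdeal (invVar i) * Ideal.Quotient.mk eqIdeal (diffPoly i)
      = 1 := by
    have := Ideal.Quotient.eq_zero_iff_mem.2 (inv_mul_diff_sub_one_mem i)
    rwa [map_sub, map_mul, map_one, sub_eq_zero] at this
  have hrel : diffPoly (.inl 0) * diffPoly (.inr (1, 0)) -
      diffPoly (.inl (0, 1)) * diffPoly (.inr 0) = quad (-1, 0) - quad 0 := by
    have h0 : ((0 : ℤ), (0 : ℤ)) = 0 := rfl
    simp [diffPoly, planeEnds, rowEnds, quad, h0]
    ring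
  have h1 : diffPoly (.inl 0) * diffPoly (.inr (1, 0)) -
      diffPoly (.inl (0, 1)) * diffPoly (.inr 0) ∈ eqIdeal := hrel ▸ quad_sub_quad_mem _ _
  have h2 := Ideal.Quotient.eq_zero_iff_mem.2 (planeDer_mem_eqIdeal k h1)
  rw [← Ideal.Quotient.eq_zero_iff_mem, map_sub, map_mul, map_mul, sub_eq_zero] at h1
  simp only [map_sub, Derivation.leibniz, map_add, smul_eq_mul, map_mul] at h2
  have key := der_log_ring (hinv (.inl 0)) (hinv (.inr (1, 0))) (hinv (.inl (0, 1)))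
    (hinv (.inr 0)) h1 (a := Ideal.Quotient.mk eqIdeal (planeDer k (diffPoly (.inl 0))))
    (b := Ideal.Quotient.mk eqIdeal (planeDer k (diffPoly (.inr (1, 0)))))
    (a' := Ideal.Quotient.mk eqIdeal (planeDer k (diffPoly (.inl (0, 1)))))
    (b' := Ideal.Quotient.mk eqIdeal (planeDer k (diffPoly (.inr 0))))
    (by linear_combination h2)
  rw [← Ideal.Quotient.eq_zero_iff_mem]
  simp only [lawPoly, map_add, map_sub, map_neg, der_log, map_mul]
  simp only [diffPoly, map_sub, der_coord] at key
  linear_combination key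

lemma iterate_planeDer_mem (k : ℤ) (n : ℕ) {f : PlanePoly} (hf : f ∈ eqIdeal) :
    (planeDer k)^[n] f ∈ eqIdeal := by
  induction n with
  | zero => exact hf
  | succ n ih =>
    rw [iterate_succ_apply']
    exact planeDer_mem_eqIdeal k ih

/-! ### The conservation laws -/

lemma mem_regular_planeEnds {α β : ℝ} (hαβ : α ≠ β) {u : Config} (hu : u ∈ HRegular)
    (hsol : IsSolution α β u) : u ∈ Regular planeEnds := by
  rintro (p | p)
  · exact hu p
  · intro h
    have hp := hsol (p - (1, 0))
    have h1 : p - (1, 0) + (1, 1) = p + (0, 1) := by ext <;> simp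
    simp only [planeEnds, Sum.elim_inr] at h
    rw [h1, h, sub_self, zero_mul, zero_add] at hp
    exact hαβ (sub_eq_zero.1 hp).symm

/-- The logarithm of the identity
`(u_{1,0} - u_{-1,0}) (u_{1,1} - u_{0,0}) = (u_{1,1} - u_{-1,1}) (u_{0,1} - u_{-1,0})`. -/
lemma ev_lawPoly {α β : ℝ} {u : Config} (hu : u ∈ Regular planeEnds)
    (hsol : IsSolution α β u) : ev planeEnds u lawPoly = 0 := by
  have h1 : u (1, 0) - u (-1, 0) ≠ 0 := sub_ne_zero.2 (hu (.inl 0))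
  have h2 : u (1, 1) - u (-1, 1) ≠ 0 := by
    simpa [planeEnds, rowEnds] using sub_ne_zero.2 (hu (.inl (0, 1)))
  have h3 : u (1, 1) - u 0 ≠ 0 := by simpa [planeEnds] using sub_ne_zero.2 (hu (.inr (1, 0)))
  have h4 : u (0, 1) - u (-1, 0) ≠ 0 := sub_ne_zero.2 (hu (.inr 0))
  have e0 := hsol 0
  have e1 := hsol (-1, 0)
  simp only [zero_add, Prod.mk_add_mk, neg_add_cancel, add_zero] at e0 e1
  have h0 : u (0, 0) = u 0 := rfl
  have h : (u (1, 0) - u (-1, 0)) * (u (1, 1) - u 0) =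
      (u (1, 1) - u (-1, 1)) * (u (0, 1) - u (-1, 0)) := by
    rw [h0] at e1
    linear_combination e1 - e0
  have hlog := congrArg Real.log h
  rw [Real.log_mul h1 h3, Real.log_mul h2 h4] at hlog
  simp [lawPoly, planeEnds, rowEnds]
  linear_combination hlog

lemma vanishesOnSolutions_law {α β : ℝ} (hαβ : α ≠ β) (n : ℕ) :
    VanishesOnSolutions α β HRegular ((Sl (Gn n) - Gn n) + (Sk (Fn n) - Fn n)) := by
  intro u hu hsol k l
  have hreg := mem_regular_planeEnds hαβ hu hsol
  have e1 : Sl (Gn n) α β k l u = ev planeEnds u ((planeDer k)^[n] (-logVar (.inl (0, 1)))) := by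
    rw [Sl, Gn, ← iterate_apply_shift]
    refine iterate_X_apply_eq_ev ?_ n α β k l hreg
    intros
    simp [shift, G, planeEnds, rowEnds]
  have e2 : Gn n α β k l u = ev planeEnds u ((planeDer k)^[n] (-logVar (.inl 0))) := by
    refine iterate_X_apply_eq_ev ?_ n α β k l hreg
    intros
    simp [G, planeEnds, rowEnds]
  have e3 : Sk (Fn n) α β k l u = ev planeEnds u ((planeDer k)^[n] (logVar (.inr (1, 0)))) := by
    rw [Sk, Fn, ← iterate_apply_shift]
    refine iterate_X_apply_eq_ev ?_ n α β k l hreg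
    intros
    simp [shift, F, planeEnds]
    rfl
  have e4 : Fn n α β k l u = ev planeEnds u ((planeDer k)^[n] (logVar (.inr 0))) := by
    refine iterate_X_apply_eq_ev ?_ n α β k l hreg
    intros
    simp [F, planeEnds]
  simp only [Pi.add_apply, Pi.sub_apply, e1, e2, e3, e4]
  rw [← map_sub, ← map_sub, ← map_add, ← iterate_map_sub, ← iterate_map_sub, ← iterate_map_add]
  change ev planeEnds u ((planeDer k)^[n] lawPoly) = 0
  cases n with
  | zero => exact ev_lawPoly hreg hsol
  | succ n =>
    rw [iterate_succ_apply]
    exact ev_eq_zero_of_mem_eqIdeal hreg hsol (iterate_planeDer_mem k n (planeDer_lawPoly_mem k))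

/-- Applying `X` to a function enlarges the set of values it depends on at most by the horizontal
neighbours. -/
lemma dependsOn_X_apply {A : LatticeFun} {S T : Set (ℤ × ℤ)}
    (hA : ∀ α β k l, DependsOn (A α β k l) S)
    (hST : ∀ p ∈ S, p ∈ T ∧ p + (1, 0) ∈ T ∧ p - (1, 0) ∈ T) (α β : ℝ) (k l : ℤ) :
    DependsOn (X.apply A α β k l) T := by
  intro u v huv
  have hS (a b : ℝ) : A a b k l u = A a b k l v :=
    hA a b k l fun p hp => huv p (hST p hp).1
  simp only [Generator.apply, hS]
  congr 2
  refine finsum_congr fun p => ?_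
  by_cases hp : p ∈ S
  · obtain ⟨h0, h1, h2⟩ := hST p hp
    have hpart : partialU p A α β k l u = partialU p A α β k l v := by
      simp only [partialU, huv p h0]
      congr 1
      funext t
      refine hA α β k l fun q hq => ?_
      simp only [update_apply]
      rw [huv q (hST q hq).1]
    rw [hpart, shift_X_Q, shift_X_Q, speed, speed, huv _ h1, huv _ h2]
  · have hpart (w : Config) : partialU p A α β k l w = 0 := by
      simp only [partialU]
      have : (fun t => A α β k l (update w p t)) = fun _ => A α β k l w := by
        funext t
        refine hA α β k l fun q hq => ?_
        rw [update_of_ne]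
        rintro rfl
        exact hp hq
      rw [this, deriv_const]
    rw [hpart, hpart, mul_zero, mul_zero]

/-- The lattice points `(i, j)` with `|i| ≤ n + 1` and `0 ≤ j ≤ m`. -/
def strip (n : ℕ) (m : ℤ) : Set (ℤ × ℤ) := Set.Icc (-(n + 1 : ℤ), 0) ((n + 1 : ℤ), m)

lemma mem_strip {n : ℕ} {m : ℤ} {p : ℤ × ℤ} :
    p ∈ strip n m ↔ (-(n + 1 : ℤ) ≤ p.1 ∧ 0 ≤ p.2) ∧ p.1 ≤ n + 1 ∧ p.2 ≤ m :=
  Iff.rfl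

lemma dependsOn_iterate_X_apply {A : LatticeFun} {m : ℤ}
    (hA : ∀ α β k l, DependsOn (A α β k l) (strip 0 m)) (n : ℕ) :
    ∀ α β k l, DependsOn (X.apply^[n] A α β k l) (strip n m) := by
  induction n with
  | zero => exact hA
  | succ n ih =>
    rw [iterate_succ_apply']
    refine dependsOn_X_apply ih fun p hp => ?_
    simp only [mem_strip, Prod.fst_add, Prod.snd_add, Prod.fst_sub, Prod.snd_sub] at hp ⊢
    push_cast
    omega

lemma dependsOn_Gn (n : ℕ) (α β : ℝ) (k l : ℤ) : DependsOn (Gn n α β k l) (strip n 0) := by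
  refine dependsOn_iterate_X_apply (fun α β k l u v huv => ?_) n α β k l
  simp only [G]
  rw [huv (1, 0) (by simp [mem_strip]), huv (-1, 0) (by simp [mem_strip])]

lemma dependsOn_Fn (n : ℕ) (α β : ℝ) (k l : ℤ) : DependsOn (Fn n α β k l) (strip n 1) := by
  refine dependsOn_iterate_X_apply (fun α β k l u v huv => ?_) n α β k l
  simp only [F]
  rw [huv (0, 1) (by simp [mem_strip]), huv (-1, 0) (by simp [mem_strip])]

lemma isLocal_of_dependsOn_strip {A : LatticeFun} {n : ℕ} {m : ℤ}
    (hA : ∀ α β k l, DependsOn (A α β k l) (strip n m)) : IsLocal A :=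
  ⟨Finset.Icc (-(n + 1 : ℤ), 0) ((n + 1 : ℤ), m), fun α β k l => by
    rw [Finset.coe_Icc]; exact hA α β k l⟩

lemma onHorizontalLine_Gn (n : ℕ) : OnHorizontalLine (Gn n) := by
  intro α β k l u v huv
  refine dependsOn_Gn n α β k l fun p hp => huv p ?_
  rw [mem_strip] at hp
  exact le_antisymm hp.2.2 hp.1.2

lemma isConservationLaw {α β : ℝ} (hαβ : α ≠ β) (n : ℕ) :
    IsConservationLaw α β HRegular (Fn n) (Gn n) :=
  ⟨isLocal_of_dependsOn_strip (dependsOn_Fn n), isLocal_of_dependsOn_strip (dependsOn_Gn n),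
    vanishesOnSolutions_law hαβ n⟩

/-! ### Solutions with prescribed rows -/

/-- The map `y ↦ a - δ / (b - y)`. With the convention `1 / 0 = 0` it is a bijection of the whole
real line. -/
noncomputable def stepEquiv {δ : ℝ} (hδ : δ ≠ 0) (a b : ℝ) : ℝ ≃ ℝ where
  toFun y := a - δ / (b - y)
  invFun y := b - δ / (a - y)
  left_inv y := by simp [div_div_cancel₀ hδ]
  right_inv y := by simp [div_div_cancel₀ hδ]

/-- Composition of the members of a two-sided sequence of bijections, starting at `a`. -/
lemma exists_orbit (e : ℤ → ℝ ≃ ℝ) (a : ℤ) :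
    ∃ E : ℤ → ℝ ≃ ℝ, E a = Equiv.refl ℝ ∧ ∀ i, E (i + 1) = (E i).trans (e i) := by
  let P : ℕ → ℝ ≃ ℝ := fun n => Nat.rec (Equiv.refl ℝ) (fun n q => q.trans (e (n + a))) n
  let N : ℕ → ℝ ≃ ℝ :=
    fun n => Nat.rec (Equiv.refl ℝ) (fun n q => q.trans (e (Int.negSucc n + a)).symm) n
  let E : ℤ → ℝ ≃ ℝ
    | .ofNat n => P n
    | .negSucc n => N (n + 1)
  have hE (i : ℤ) : E (i + 1) = (E i).trans (e (i + a)) := by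
    cases i with
    | ofNat n => rfl
    | negSucc n =>
      have h : E (Int.negSucc n + 1) = N n := by
        cases n with
        | zero => rfl
        | succ n => rfl
      rw [h]
      change N n = ((N n).trans (e (Int.negSucc n + a)).symm).trans (e (Int.negSucc n + a))
      rw [Equiv.trans_assoc, Equiv.symm_trans_self, Equiv.trans_refl]
  have hE0 : E 0 = Equiv.refl ℝ := rfl
  refine ⟨fun i => E (i - a), by simp only [sub_self, hE0], fun i => ?_⟩
  have := hE (i - a)
  rwa [sub_add_cancel, sub_add_eq_add_sub] at this

/-- No two values at distance two coincide in the row `r`. -/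
def RowRegular (r : ℤ → ℝ) : Prop := ∀ i, r (i + 1) ≠ r (i - 1)

/-- The equation with `δ = α - β` for two adjacent rows. -/
def Adjacent (δ : ℝ) (r s : ℤ → ℝ) : Prop :=
  ∀ i, (r i - s (i + 1)) * (r (i + 1) - s i) = δ

lemma Adjacent.symm {δ : ℝ} {r s : ℤ → ℝ} (h : Adjacent δ r s) : Adjacent δ s r := by
  intro i
  rw [← h i]
  ring

/-- All but countably many initial values extend to a row adjacent to a given one. -/
lemma exists_adjacent_family {δ : ℝ} (hδ : δ ≠ 0) {r : ℤ → ℝ} (hr : RowRegular r) (a : ℤ) :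
    ∃ (s : ℝ → ℤ → ℝ) (B : Set ℝ), B.Countable ∧ (∀ x, s x a = x) ∧
      (∀ x i, s x (i + 1) = r i - δ / (r (i + 1) - s x i)) ∧
      ∀ x, x ∉ B → RowRegular (s x) ∧ Adjacent δ r (s x) := by
  obtain ⟨E, hE0, hE⟩ := exists_orbit (fun i => stepEquiv hδ (r i) (r (i + 1))) a
  have hstep (x : ℝ) (i : ℤ) : E (i + 1) x = r i - δ / (r (i + 1) - E i x) := by
    rw [hE]
    rfl
  refine ⟨fun x i => E i x, ⋃ i, E i ⁻¹' {r (i + 1)},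
    Set.countable_iUnion fun i => (Set.countable_singleton _).preimage (E i).injective,
    fun x => by simp [hE0], hstep, fun x hx => ?_⟩
  have hne (i : ℤ) : r (i + 1) - E i x ≠ 0 := by
    intro h
    exact hx (Set.mem_iUnion.2 ⟨i, (sub_eq_zero.1 h).symm⟩)
  have hadj : Adjacent δ r (fun i => E i x) := by
    intro i
    simp only [hstep]
    field_simp [hne i]
    ring
  refine ⟨fun i h => ?_, hadj⟩
  have h1 := hadj i
  have h2 := hadj (i - 1)
  simp only [sub_add_cancel] at h1 h2
  have h3 : r i - E (i + 1) x ≠ 0 := left_ne_zero_of_mul (h1.trans_ne hδ)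
  have h : E (i + 1) x = E (i - 1) x := h
  rw [← h, mul_comm] at h2
  have := mul_left_cancel₀ h3 (h1.trans h2.symm)
  exact hr i (sub_left_injective this)

/-- Two rows have adjacent rows that agree as far as the given rows agree. -/
lemma exists_adjacent_pair {δ : ℝ} (hδ : δ ≠ 0) {r r' : ℤ → ℝ} (hr : RowRegular r)
    (hr' : RowRegular r') (a : ℤ) :
    ∃ s s' : ℤ → ℝ, RowRegular s ∧ RowRegular s' ∧ Adjacent δ r s ∧ Adjacent δ r' s' ∧
      ((∀ i ≤ a, r i = r' i) → ∀ i ≤ a, s i = s' i) ∧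
      ((∀ i, a ≤ i → r i = r' i) → ∀ i, a ≤ i → s i = s' i) := by
  obtain ⟨s, B, hB, hs0, hs, hsB⟩ := exists_adjacent_family hδ hr a
  obtain ⟨s', B', hB', hs0', hs', hsB'⟩ := exists_adjacent_family hδ hr' a
  obtain ⟨x, hx⟩ : ∃ x, x ∉ B ∪ B' := by
    by_contra! h
    exact Set.not_countable_univ ((hB.union hB').mono fun x _ => h x)
  rw [Set.mem_union, not_or] at hx
  obtain ⟨h1, h2⟩ := hsB x hx.1
  obtain ⟨h1', h2'⟩ := hsB' x hx.2
  refine ⟨s x, s' x, h1, h1', h2, h2', fun h i hi => ?_, fun h i hi => ?_⟩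
  · induction i, hi using Int.leInductionDown with
    | base => rw [hs0, hs0']
    | pred i hi ih =>
      have e1 := h2 (i - 1)
      have e2 := h2' (i - 1)
      simp only [sub_add_cancel] at e1 e2
      rw [← h i hi, ← h (i - 1) (by omega), ← ih] at e2
      have := mul_left_cancel₀ (left_ne_zero_of_mul (e1.trans_ne hδ)) (e1.trans e2.symm)
      exact sub_right_injective this
  · induction i, hi using Int.leInduction with
    | base => rw [hs0, hs0']
    | succ i hi ih => rw [hs, hs', ih, h i hi, h (i + 1) (by omega)]

/-- Iteration of `exists_adjacent_pair`; `P` is the property of agreeing on a half-line. -/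
lemma exists_tower {δ : ℝ} {P : (ℤ → ℝ) → (ℤ → ℝ) → Prop}
    (hP : ∀ r r', RowRegular r → RowRegular r' → P r r' → ∃ s s', RowRegular s ∧ RowRegular s' ∧
      Adjacent δ r s ∧ Adjacent δ r' s' ∧ P s s')
    {r r' : ℤ → ℝ} (hr : RowRegular r) (hr' : RowRegular r') (h : P r r') :
    ∃ R R' : ℕ → ℤ → ℝ, R 0 = r ∧ R' 0 = r' ∧ (∀ j, RowRegular (R j) ∧ RowRegular (R' j)) ∧
      (∀ j, Adjacent δ (R j) (R (j + 1)) ∧ Adjacent δ (R' j) (R' (j + 1))) ∧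
      ∀ j, P (R j) (R' j) := by
  let T := {q : (ℤ → ℝ) × (ℤ → ℝ) // RowRegular q.1 ∧ RowRegular q.2 ∧ P q.1 q.2}
  have hT (q : T) : ∃ q' : T, Adjacent δ q.1.1 q'.1.1 ∧ Adjacent δ q.1.2 q'.1.2 := by
    obtain ⟨s, s', h1, h2, h3, h4, h5⟩ := hP _ _ q.2.1 q.2.2.1 q.2.2.2
    exact ⟨⟨(s, s'), h1, h2, h5⟩, h3, h4⟩
  obtain ⟨next, hnext⟩ := Classical.axiomOfChoice hT
  let seq : ℕ → T := fun n => next^[n] ⟨(r, r'), hr, hr', h⟩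
  have hseq (n : ℕ) : seq (n + 1) = next (seq n) := iterate_succ_apply' ..
  refine ⟨fun n => (seq n).1.1, fun n => (seq n).1.2, rfl, rfl,
    fun j => ⟨(seq j).2.1, (seq j).2.2.1⟩, fun j => ?_, fun j => (seq j).2.2.2⟩
  simp only [hseq]
  exact hnext (seq j)

/-- Two towers over the same row, one upwards and one downwards, form a solution. -/
lemma exists_solution_of_towers {α β : ℝ} {R D : ℕ → ℤ → ℝ} (h0 : R 0 = D 0)
    (hR : ∀ j, RowRegular (R j)) (hD : ∀ j, RowRegular (D j))
    (hR' : ∀ j, Adjacent (α - β) (R j) (R (j + 1)))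
    (hD' : ∀ j, Adjacent (α - β) (D j) (D (j + 1))) :
    ∃ u ∈ HRegular, IsSolution α β u ∧ (∀ (j : ℕ) i, u (i, (j : ℤ)) = R j i) ∧
      ∀ (j : ℕ) i, u (i, -(j : ℤ)) = D j i := by
  let W : ℤ → ℤ → ℝ
    | .ofNat n => R n
    | .negSucc n => D (n + 1)
  have hWneg (n : ℕ) : W (-(n : ℤ)) = D n := by
    cases n with
    | zero => exact h0
    | succ n => rfl
  have hW (j : ℤ) : RowRegular (W j) := by
    cases j with
    | ofNat n => exact hR n
    | negSucc n => exact hD (n + 1)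
  have hW' (j : ℤ) : Adjacent (α - β) (W j) (W (j + 1)) := by
    cases j with
    | ofNat n => exact hR' n
    | negSucc n =>
      have h : Int.negSucc n + 1 = -(n : ℤ) := by omega
      rw [h, hWneg]
      exact (hD' n).symm
  refine ⟨fun p => W p.2 p.1, fun p => ?_, fun p => ?_, fun j i => rfl,
    fun j i => congrFun (hWneg j) i⟩
  · simpa using hW p.2 p.1
  · have := hW' p.2 p.1
    simp only [Prod.fst_add, Prod.snd_add, add_zero]
    linarith

/-- Two regular rows that agree for `i ≤ a` and for `i ≥ b` are the rows `j = 0` of two solutions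
that agree to the upper left and to the lower right of where the rows differ. -/
lemma exists_solutions {α β : ℝ} (hαβ : α ≠ β) {r r' : ℤ → ℝ} (hr : RowRegular r)
    (hr' : RowRegular r') {a b : ℤ} (ha : ∀ i ≤ a, r i = r' i) (hb : ∀ i, b ≤ i → r i = r' i) :
    ∃ u ∈ HRegular, ∃ u' ∈ HRegular, IsSolution α β u ∧ IsSolution α β u' ∧
      (∀ i, u (i, 0) = r i) ∧ (∀ i, u' (i, 0) = r' i) ∧
      (∀ i j, i ≤ a → 0 ≤ j → u (i, j) = u' (i, j)) ∧
      (∀ i j, b ≤ i → j ≤ 0 → u (i, j) = u' (i, j)) := by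
  have hδ : α - β ≠ 0 := sub_ne_zero.2 hαβ
  obtain ⟨R, R', hR0, hR0', hR, hRadj, hRP⟩ := exists_tower
    (δ := α - β) (P := fun r r' => ∀ i ≤ a, r i = r' i) (fun r r' hr hr' h => by
      obtain ⟨s, s', h1, h2, h3, h4, h5, -⟩ := exists_adjacent_pair hδ hr hr' a
      exact ⟨s, s', h1, h2, h3, h4, h5 h⟩) hr hr' ha
  obtain ⟨D, D', hD0, hD0', hD, hDadj, hDP⟩ := exists_tower
    (δ := α - β) (P := fun r r' => ∀ i, b ≤ i → r i = r' i) (fun r r' hr hr' h => by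
      obtain ⟨s, s', h1, h2, h3, h4, -, h5⟩ := exists_adjacent_pair hδ hr hr' b
      exact ⟨s, s', h1, h2, h3, h4, h5 h⟩) hr hr' hb
  obtain ⟨u, hu, hsol, hup, hdown⟩ := exists_solution_of_towers (hR0.trans hD0.symm)
    (fun j => (hR j).1) (fun j => (hD j).1) (fun j => (hRadj j).1) fun j => (hDadj j).1
  obtain ⟨u', hu', hsol', hup', hdown'⟩ := exists_solution_of_towers (hR0'.trans hD0'.symm)
    (fun j => (hR j).2) (fun j => (hD j).2) (fun j => (hRadj j).2) fun j => (hDadj j).2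
  refine ⟨u, hu, u', hu', hsol, hsol', fun i => ?_, fun i => ?_, fun i j hi hj => ?_,
    fun i j hi hj => ?_⟩
  · rw [← hR0]; exact hup 0 i
  · rw [← hR0']; exact hup' 0 i
  · lift j to ℕ using hj
    rw [hup, hup', hRP j i hi]
  · obtain ⟨m, rfl⟩ := Int.exists_eq_neg_ofNat hj
    rw [hdown, hdown', hDP m i hi]

/-! ### Nontriviality -/

lemma IsSolution.comp_add {α β : ℝ} {u : Config} (hu : IsSolution α β u) (r : ℤ × ℤ) :
    IsSolution α β (fun q => u (q + r)) := by
  intro p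
  have := hu (p + r)
  simpa only [add_right_comm] using this

/-- The potential of a trivial law at neighbouring points of a row. -/
lemma sum_row {α β : ℝ} {f B G₀ : LatticeFun} (hG₀ : VanishesOnSolutions α β HRegular G₀)
    (hB : B = G₀ + (Sk f - f)) {u : Config} (hu : u ∈ HRegular) (hsol : IsSolution α β u)
    (K : ℕ) :
    ∑ i ∈ Finset.range K, B α β i 0 (fun q => u (q + ((i : ℤ), 0))) =
      f α β K 0 (fun q => u (q + ((K : ℤ), 0))) - f α β 0 0 u := by
  have h (i : ℕ) : B α β i 0 (fun q => u (q + ((i : ℤ), 0))) =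
      f α β ((i + 1 : ℕ) : ℤ) 0 (fun q => u (q + (((i + 1 : ℕ) : ℤ), 0))) -
        f α β (i : ℤ) 0 (fun q => u (q + ((i : ℤ), 0))) := by
    have hz := hG₀ _ (comp_add_mem_HRegular hu ((i : ℤ), 0)) (hsol.comp_add _) i 0
    simp only [hB, Pi.add_apply, Pi.sub_apply, hz, zero_add, Sk, shift, add_assoc,
      Prod.mk_add_mk, add_zero]
    push_cast
    simp only [add_comm (1 : ℤ)]
  rw [Finset.sum_congr rfl fun i _ => h i,
    Finset.sum_range_sub (fun i : ℕ => f α β (i : ℤ) 0 (fun q => u (q + ((i : ℤ), 0))))]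
  have h0 : ((0 : ℤ), (0 : ℤ)) = 0 := rfl
  simp [h0]

/-- The potential of a trivial law at neighbouring points of a column. -/
lemma sum_column {α β : ℝ} {f A F₀ : LatticeFun} (hF₀ : VanishesOnSolutions α β HRegular F₀)
    (hA : A = F₀ - (Sl f - f)) {u : Config} (hu : u ∈ HRegular) (hsol : IsSolution α β u)
    (c d : ℤ) (N : ℕ) :
    ∑ j ∈ Finset.range N, A α β c (d + j) (fun q => u (q + (c, d + j))) =
      f α β c d (fun q => u (q + (c, d))) - f α β c (d + N) (fun q => u (q + (c, d + N))) := by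
  have h (j : ℕ) : A α β c (d + j) (fun q => u (q + (c, d + j))) =
      f α β c (d + j) (fun q => u (q + (c, d + j))) -
        f α β c (d + (j + 1 : ℕ)) (fun q => u (q + (c, d + (j + 1 : ℕ)))) := by
    have hz := hF₀ _ (comp_add_mem_HRegular hu (c, d + j)) (hsol.comp_add _) c (d + j)
    simp only [hA, Pi.sub_apply, hz, Sl, shift, add_assoc, Prod.mk_add_mk, add_zero,
      zero_add]
    push_cast
    simp only [add_comm (1 : ℤ), add_assoc]
    ring
  rw [Finset.sum_congr rfl fun j _ => h j,
    Finset.sum_range_sub' (fun j : ℕ => f α β c (d + j) (fun q => u (q + (c, d + j))))]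
  simp

/-- If a law is trivial, then the sum of `B` along a row depends only on the ends of the row. The
ends are joined to the parts where two solutions agree by vertical steps. -/
lemma sum_row_eq_of_isTrivial {α β : ℝ} {f A B F₀ G₀ : LatticeFun}
    (hF₀ : VanishesOnSolutions α β HRegular F₀) (hG₀ : VanishesOnSolutions α β HRegular G₀)
    (hA : A = F₀ - (Sl f - f)) (hB : B = G₀ + (Sk f - f)) {S K : ℕ}
    (hf : ∀ k l, DependsOn (f α β k l) (Set.Icc (-(S : ℤ), -(S : ℤ)) ((S : ℤ), (S : ℤ))))
    (hAdep : ∀ k l, DependsOn (A α β k l) (Set.Icc (-(S : ℤ), 0) ((S : ℤ), 1)))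
    {u u' : Config} (hu : u ∈ HRegular) (hu' : u' ∈ HRegular) (hsol : IsSolution α β u)
    (hsol' : IsSolution α β u') (hup : ∀ i j, i ≤ (S : ℤ) → 0 ≤ j → u (i, j) = u' (i, j))
    (hdown : ∀ i j, (K : ℤ) - S ≤ i → j ≤ 0 → u (i, j) = u' (i, j)) :
    ∑ i ∈ Finset.range K, B α β i 0 (fun q => u (q + ((i : ℤ), 0))) =
      ∑ i ∈ Finset.range K, B α β i 0 (fun q => u' (q + ((i : ℤ), 0))) := by
  rw [sum_row hG₀ hB hu hsol, sum_row hG₀ hB hu' hsol']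
  have hleft : f α β 0 0 u = f α β 0 0 u' := by
    have e := sum_column hF₀ hA hu hsol 0 0 S
    have e' := sum_column hF₀ hA hu' hsol' 0 0 S
    have h1 : ∑ j ∈ Finset.range S, A α β 0 (0 + j) (fun q => u (q + (0, 0 + (j : ℤ)))) =
        ∑ j ∈ Finset.range S, A α β 0 (0 + j) (fun q => u' (q + (0, 0 + (j : ℤ)))) := by
      refine Finset.sum_congr rfl fun j _ => hAdep _ _ ?_
      rintro ⟨i, m⟩ hp
      simp only [Set.mem_Icc, Prod.mk_le_mk] at hp
      exact hup _ _ (by simp; omega) (by simp; omega)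
    have h2 : f α β 0 (0 + S) (fun q => u (q + (0, 0 + (S : ℤ)))) =
        f α β 0 (0 + S) (fun q => u' (q + (0, 0 + (S : ℤ)))) := by
      refine hf _ _ ?_
      rintro ⟨i, m⟩ hp
      simp only [Set.mem_Icc, Prod.mk_le_mk] at hp
      exact hup _ _ (by simp; omega) (by simp; omega)
    have h0 : ((0 : ℤ), (0 : ℤ)) = 0 := rfl
    rw [h1, h2] at e
    simp only [h0, add_zero] at e e'
    linarith
  have hright : f α β K 0 (fun q => u (q + ((K : ℤ), 0))) =
      f α β K 0 (fun q => u' (q + ((K : ℤ), 0))) := by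
    have e := sum_column hF₀ hA hu hsol K (-S) S
    have e' := sum_column hF₀ hA hu' hsol' K (-S) S
    have h1 : ∑ j ∈ Finset.range S, A α β K (-S + j) (fun q => u (q + ((K : ℤ), -S + (j : ℤ)))) =
        ∑ j ∈ Finset.range S, A α β K (-S + j) (fun q => u' (q + ((K : ℤ), -S + (j : ℤ)))) := by
      refine Finset.sum_congr rfl fun j hj => hAdep _ _ ?_
      rintro ⟨i, m⟩ hp
      rw [Finset.mem_range] at hj
      simp only [Set.mem_Icc, Prod.mk_le_mk] at hp
      exact hdown _ _ (by simp; omega) (by simp; omega)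
    have h2 : f α β K (-S) (fun q => u (q + ((K : ℤ), -(S : ℤ)))) =
        f α β K (-S) (fun q => u' (q + ((K : ℤ), -(S : ℤ)))) := by
      refine hf _ _ ?_
      rintro ⟨i, m⟩ hp
      simp only [Set.mem_Icc, Prod.mk_le_mk] at hp
      exact hdown _ _ (by simp; omega) (by simp; omega)
    rw [h1, h2] at e
    simp only [neg_add_cancel] at e e'
    linarith
  rw [hleft, hright]

lemma eulerPoly_gPoly_eq_sum {n m K : ℕ} (h1 : n + 1 ≤ m) (h2 : m + n + 1 < K) :
    translate ((m : ℤ), 0) (eulerPoly (gPoly n) m) =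
      derU ((m : ℤ), 0) (∑ i ∈ Finset.range K, translate ((i : ℤ), 0) (gPoly n i)) := by
  rw [eulerPoly, finsum_eq_sum_of_support_subset
    (s := (Finset.range K).image fun i : ℕ => ((m : ℤ) - i, (0 : ℤ))), Finset.sum_image, map_sum,
    map_sum]
  · refine Finset.sum_congr rfl fun i _ => ?_
    rw [translate_translate, derU_translate]
    simp
  · intro i _ j _ hij
    simpa using hij
  · intro p hp
    by_contra h
    refine hp ?_
    simp only
    rw [derU_gPoly_eq_zero, map_zero]
    rintro ⟨h3, h4, h5⟩
    apply h
    simp only [Finset.coe_image, Set.mem_image, Finset.coe_range, Set.mem_Iio]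
    refine ⟨((m : ℤ) - p.1).toNat, by omega, ?_⟩
    ext
    · simp only
      omega
    · exact h5.symm

/-- The `(F_n, G_n)` are linearly independent modulo trivial laws: the derivative of the sum of
`G` along a row with respect to an inner value is the Euler operator applied to `G`. -/
lemma not_isTrivial_sum {α β : ℝ} (hαβ : α ≠ β) {c : ℕ →₀ ℝ} (hc : c ≠ 0) :
    ¬ IsTrivial α β HRegular (c.sum fun n a => a • Fn n) (c.sum fun n a => a • Gn n) := by
  rintro ⟨f, F₀, G₀, ⟨s, hs⟩, -, -, hF₀, hG₀, hA, hB⟩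
  obtain ⟨S, hSc, hSs⟩ : ∃ S : ℕ, (∀ n ∈ c.support, n + 1 ≤ S) ∧
      ∀ p ∈ s, p.1.natAbs ≤ S ∧ p.2.natAbs ≤ S := by
    refine ⟨max (c.support.sup (· + 1)) (s.sup fun p => max p.1.natAbs p.2.natAbs),
      fun n hn => ?_, fun p hp => ?_⟩
    · exact (Finset.le_sup (f := (· + 1)) hn).trans (le_max_left _ _)
    · have := (Finset.le_sup (f := fun p : ℤ × ℤ => max p.1.natAbs p.2.natAbs) hp).trans
        (le_max_right (c.support.sup (· + 1)) _)
      exact ⟨(le_max_left _ _).trans this, (le_max_right _ _).trans this⟩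
  -- The value at `m` is varied. It lies more than `S` away from the ends `0` and `K` of the row, so
  -- that the windows around the ends avoid it and the sum contains every `G` that depends on it.
  set m : ℕ := 2 * S + 1 with hm
  set K : ℕ := 4 * S + 2 with hK
  have hf (k l) : DependsOn (f α β k l) (Set.Icc (-(S : ℤ), -(S : ℤ)) ((S : ℤ), (S : ℤ))) := by
    intro u v huv
    refine hs α β k l fun p hp => huv p ?_
    have := hSs p hp
    simp only [Set.mem_Icc, Prod.le_def]
    omega
  have hAdep (k l) : DependsOn ((c.sum fun n a => a • Fn n) α β k l)
      (Set.Icc (-(S : ℤ), 0) ((S : ℤ), 1)) := by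
    intro u v huv
    simp only [Finsupp.sum, Finset.sum_apply, Pi.smul_apply]
    refine Finset.sum_congr rfl fun n hn => ?_
    rw [dependsOn_Fn n α β k l fun p hp => huv p ?_]
    have := hSc n hn
    simp only [mem_strip] at hp
    simp only [Set.mem_Icc, Prod.le_def]
    omega
  obtain ⟨u₁, hu₁, hne⟩ := exists_sum_euler_ne_zero hc (m : ℤ)
  set u₀ : Config := fun q => u₁ (q + (-(m : ℤ), 0)) with hu₀_def
  have hu₀ : u₀ ∈ HRegular := comp_add_mem_HRegular hu₁ _
  -- the sum of `G` along the row, as a polynomial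
  set T : Poly (ℤ × ℤ) := c.sum fun n a =>
    C a * ∑ i ∈ Finset.range K, translate ((i : ℤ), 0) (gPoly n i) with hT
  have hTev {u : Config} (hu : u ∈ HRegular) : ev rowEnds u T =
      ∑ i ∈ Finset.range K, (c.sum fun n a => a • Gn n) α β i 0
        (fun q => u (q + ((i : ℤ), 0))) := by
    simp only [hT, Finsupp.sum, Finset.sum_apply, Pi.smul_apply, map_sum, map_mul, ev_C,
      ev_translate, smul_eq_mul, Gn_eq_ev _ _ _ _ _ (comp_add_mem_HRegular hu _), Finset.mul_sum]
    exact Finset.sum_comm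
  have hTrow {u v : Config} (hu : u ∈ HRegular) (hv : v ∈ HRegular)
      (huv : ∀ i, u (i, 0) = v (i, 0)) : ev rowEnds u T = ev rowEnds v T := by
    rw [hTev hu, hTev hv]
    refine Finset.sum_congr rfl fun i _ => ?_
    simp only [Finsupp.sum, Finset.sum_apply, Pi.smul_apply]
    refine Finset.sum_congr rfl fun n _ => ?_
    rw [onHorizontalLine_Gn n α β i 0 fun p hp => ?_]
    have : p + ((i : ℤ), 0) = (p.1 + i, 0) := by
      ext
      · rfl
      · simpa using hp
    simp only [this, huv]
  have hrow {u : Config} (hu : u ∈ HRegular) : RowRegular fun i => u (i, 0) := fun i => by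
    simpa using hu (i, 0)
  have hconst : ∀ t, update u₀ ((m : ℤ), 0) t ∈ HRegular →
      ev rowEnds (update u₀ ((m : ℤ), 0) t) T = ev rowEnds u₀ T := by
    intro t ht
    have hoff (i : ℤ) (hi : i ≠ m) : u₀ (i, 0) = update u₀ ((m : ℤ), 0) t (i, 0) := by
      rw [update_of_ne]
      simpa using hi
    obtain ⟨u, hu, u', hu', hsol, hsol', hr, hr', hup, hdown⟩ :=
      exists_solutions hαβ (hrow hu₀) (hrow ht) (a := S) (b := (K : ℤ) - S)
        (fun i hi => hoff i (by omega)) fun i hi => hoff i (by omega)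
    rw [hTrow ht hu' fun i => (hr' i).symm, hTrow hu₀ hu fun i => (hr i).symm, hTev hu, hTev hu']
    exact (sum_row_eq_of_isTrivial hF₀ hG₀ hA hB hf hAdep hu hu' hsol hsol' hup hdown).symm
  have hder := hasDerivAt_ev rowEnds hu₀ T ((m : ℤ), 0)
  have hzero : HasDerivAt (fun t => ev rowEnds (update u₀ ((m : ℤ), 0) t) T) 0
      (u₀ ((m : ℤ), 0)) := by
    refine (hasDerivAt_const _ (ev rowEnds u₀ T)).congr_of_eventuallyEq ?_
    filter_upwards [updateOpen_HRegular u₀ hu₀ ((m : ℤ), 0)] with t ht using hconst t ht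
  apply hne
  rw [← hder.unique hzero, hT]
  have hcomp : u₁ = fun q => u₀ (q + ((m : ℤ), 0)) := by
    funext q
    have h0 : ((0 : ℤ), (0 : ℤ)) = 0 := rfl
    simp [hu₀_def, add_assoc, h0]
  rw [hcomp, ← ev_translate]
  congr 1
  simp only [Finsupp.sum, map_sum, map_mul, translate_C, Derivation.leibniz, smul_eq_mul]
  refine Finset.sum_congr rfl fun n hn => ?_
  have := hSc n hn
  rw [eulerPoly_gPoly_eq_sum (K := K) (by omega) (by omega), map_sum,
    show derU ((m : ℤ), 0) (C (c n)) = 0 by rw [← algebraMap_eq]; simp, mul_zero, add_zero]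

lemma not_isTrivial {α β : ℝ} (hαβ : α ≠ β) (n : ℕ) :
    ¬ IsTrivial α β HRegular (Fn n) (Gn n) := by
  have := not_isTrivial_sum hαβ (c := Finsupp.single n 1) (by simp)
  simpa using this

/-! ### Interchange of the two lattice directions -/

/-- Interchange of the two lattice directions, together with the two parameters. -/
def swap (A : LatticeFun) : LatticeFun := fun α β k l u => A β α l k fun q => u q.swap

lemma shift_swap (p : ℤ × ℤ) (A : LatticeFun) :
    shift p (swap A) = swap (shift p.swap A) := rfl

lemma partialU_swap (p : ℤ × ℤ) (A : LatticeFun) :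
    partialU p (swap A) = swap (partialU p.swap A) := by
  funext α β k l u
  have h (t : ℝ) : (fun q : ℤ × ℤ => update u p t q.swap) =
      update (fun q => u q.swap) p.swap t := by
    funext q
    simp only [update_apply, Prod.swap_eq_iff_eq_swap]
  simp only [partialU, swap, h, Prod.swap_swap]

/-- The generator obtained by interchanging the two lattice directions. -/
def Generator.swap (Z : Generator) : Generator where
  Q := DKdV.swap Z.Q
  ξα := fun α β => Z.ξβ β α
  ξβ := fun α β => Z.ξα β α

lemma apply_swap (Z : Generator) (A : LatticeFun) :
    Z.swap.apply (swap A) = swap (Z.apply A) := by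
  funext α β k l u
  simp only [Generator.apply, partialU_swap, Generator.swap, shift_swap]
  simp only [swap, Generator.apply]
  rw [← finsum_comp_equiv (Equiv.prodComm ℤ ℤ)]
  simp only [Equiv.prodComm_apply, Prod.swap_swap]
  ring

lemma comm_swap (Z W : Generator) : Z.swap.comm W.swap = (Z.comm W).swap := by
  simp only [Generator.comm, Generator.swap, Generator.mk.injEq]
  refine ⟨?_, ?_, ?_⟩
  · change Z.swap.apply (swap W.Q) - W.swap.apply (swap Z.Q) = _
    rw [apply_swap, apply_swap]
    rfl
  · funext α β
    simp only [Generator.applyParam, Pi.sub_apply]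
    ring
  · funext α β
    simp only [Generator.applyParam, Pi.sub_apply]
    ring

lemma Yseq_eq_swap (n : ℕ) : Yseq n = (Xseq n).swap := by
  induction n with
  | zero => rfl
  | succ n ih => rw [Yseq, Xseq, ← comm_swap, ih]; rfl

lemma apply_neg (Z : Generator) (A : LatticeFun) : Z.apply (-A) = -Z.apply A := by
  have h (p : ℤ × ℤ) : partialU p (-A) = -partialU p A := by
    funext α β k l u
    exact deriv.fun_neg
  funext α β k l u
  simp only [Generator.apply, h, Pi.neg_apply, mul_neg, finsum_neg_distrib, deriv.fun_neg]
  ring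

lemma iterate_apply_neg_swap (A : LatticeFun) (n : ℕ) :
    Y.apply^[n] (-swap A) = -swap (X.apply^[n] A) := by
  induction n with
  | zero => rfl
  | succ n ih =>
    rw [iterate_succ_apply', iterate_succ_apply', ih, apply_neg, ← apply_swap]
    rfl

lemma Fbarn_eq (n : ℕ) : Fbarn n = -swap (Gn n) := by
  have h : Fbar = -swap G := by
    funext α β k l u
    simp [Fbar, swap, G]
  rw [Fbarn, h, iterate_apply_neg_swap, Gn]

lemma Gbarn_eq (n : ℕ) : Gbarn n = -swap (Fn n) := by
  have h : Gbar = -swap F := rfl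
  rw [Gbarn, h, iterate_apply_neg_swap, Fn]

lemma euler_neg_swap (A : LatticeFun) : euler (-swap A) = -swap (euler A) := by
  have h (p : ℤ × ℤ) : partialU p (-swap A) = -swap (partialU p.swap A) := by
    rw [← partialU_swap]
    funext α β k l u
    exact deriv.fun_neg
  have h' (p : ℤ × ℤ) (B : LatticeFun) : shift p (-B) = -shift p B := rfl
  funext α β k l u
  simp only [euler, h, h', shift_swap, Pi.neg_apply, finsum_neg_distrib]
  simp only [swap]
  rw [← finsum_comp_equiv (Equiv.prodComm ℤ ℤ)]
  rfl

lemma mem_HRegular_swap {u : Config} : (fun q => u q.swap) ∈ HRegular ↔ u ∈ VRegular :=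
  ⟨fun h p => h p.swap, fun h p => h p.swap⟩

lemma mem_VRegular_swap {u : Config} : (fun q => u q.swap) ∈ VRegular ↔ u ∈ HRegular :=
  ⟨fun h p => h p.swap, fun h p => h p.swap⟩

lemma isSolution_swap {α β : ℝ} {u : Config} (h : IsSolution α β u) :
    IsSolution β α (fun q => u q.swap) := by
  intro p
  have := h p.swap
  simp only [Prod.swap_add, Prod.swap_prod_mk]
  linear_combination -this

lemma vanishesOnSolutions_swap {α β : ℝ} {A : LatticeFun}
    (h : VanishesOnSolutions β α HRegular A) : VanishesOnSolutions α β VRegular (swap A) :=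
  fun _ hu hsol k l => h _ (mem_HRegular_swap.2 hu) (isSolution_swap hsol) l k

lemma vanishesOnSolutions_of_swap {α β : ℝ} {A : LatticeFun}
    (h : VanishesOnSolutions α β VRegular A) : VanishesOnSolutions β α HRegular (swap A) :=
  fun _ hu hsol k l => h _ (mem_VRegular_swap.2 hu) (isSolution_swap hsol) l k

lemma VanishesOnSolutions.neg {α β : ℝ} {D : Set Config} {A : LatticeFun}
    (h : VanishesOnSolutions α β D A) : VanishesOnSolutions α β D (-A) :=
  fun u hu hsol k l => neg_eq_zero.2 (h u hu hsol k l)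

lemma dependsOn_swap {f : Config → ℝ} {s t : Set (ℤ × ℤ)} (h : DependsOn f s)
    (hst : ∀ p ∈ s, p.swap ∈ t) : DependsOn (fun u : Config => f fun q => u q.swap) t :=
  fun _ _ huv => h fun p hp => huv p.swap (hst p hp)

lemma DependsOn.neg {f : Config → ℝ} {s : Set (ℤ × ℤ)} (h : DependsOn f s) :
    DependsOn (-f) s :=
  fun _ _ huv => congrArg Neg.neg (h huv)

lemma IsLocal.neg_swap {A : LatticeFun} (h : IsLocal A) : IsLocal (-swap A) := by
  obtain ⟨s, hs⟩ := h
  refine ⟨s.map (Equiv.prodComm ℤ ℤ).toEmbedding, fun α β k l => ?_⟩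
  refine DependsOn.neg (dependsOn_swap (hs β α l k) fun p hp => ?_)
  simpa using hp

/-- The interchange of the directions maps conservation laws `(A, B)` to conservation laws
`(-swap B, -swap A)`. -/
lemma IsConservationLaw.neg_swap {α β : ℝ} {A B : LatticeFun}
    (h : IsConservationLaw β α HRegular A B) :
    IsConservationLaw α β VRegular (-swap B) (-swap A) := by
  obtain ⟨hA, hB, hAB⟩ := h
  refine ⟨hB.neg_swap, hA.neg_swap, ?_⟩
  convert (vanishesOnSolutions_swap hAB).neg using 1
  funext α β k l u
  simp only [Sl, Sk, swap, shift, Pi.add_apply, Pi.sub_apply, Pi.neg_apply, Prod.swap_add,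
    Prod.swap_prod_mk]
  ring

/-- The interchange of the directions preserves triviality. -/
lemma isTrivial_of_neg_swap {α β : ℝ} {A B : LatticeFun}
    (h : IsTrivial α β VRegular (-swap B) (-swap A)) : IsTrivial β α HRegular A B := by
  obtain ⟨f, F₀, G₀, hf, hF, hG, hF₀, hG₀, hB, hA⟩ := h
  refine ⟨swap f, -swap G₀, -swap F₀, ?_, hG.neg_swap, hF.neg_swap,
    (vanishesOnSolutions_of_swap hG₀).neg, (vanishesOnSolutions_of_swap hF₀).neg, ?_, ?_⟩
  · obtain ⟨s, hs⟩ := hf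
    refine ⟨s.map (Equiv.prodComm ℤ ℤ).toEmbedding, fun α β k l => ?_⟩
    exact dependsOn_swap (hs β α l k) fun p hp => by simpa using hp
  · have h : A = -swap (-swap A) := by
      funext α β k l u
      simp [swap]
    rw [h, hA]
    funext α β k l u
    simp only [Sl, Sk, swap, shift, Pi.add_apply, Pi.sub_apply, Pi.neg_apply, Prod.swap_add,
      Prod.swap_prod_mk]
    ring
  · have h : B = -swap (-swap B) := by
      funext α β k l u
      simp [swap]
    rw [h, hB]
    funext α β k l u
    simp only [Sl, Sk, swap, shift, Pi.add_apply, Pi.sub_apply, Pi.neg_apply, Prod.swap_add,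
      Prod.swap_prod_mk]
    ring

lemma sum_neg_swap (c : ℕ →₀ ℝ) (A : ℕ → LatticeFun) :
    (c.sum fun n a => a • -swap (A n)) = -swap (c.sum fun n a => a • A n) := by
  funext α β k l u
  simp [Finsupp.sum, swap, Finset.sum_apply]

end DKdV
theorem theorem1 :
    -- the horizontal line
    ((∀ (n : ℕ),
        DKdV.OnHorizontalLine (DKdV.Gn n) ∧
        (∀ α β : ℝ, α ≠ β →
          DKdV.IsConservationLaw α β DKdV.HRegular (DKdV.Fn n) (DKdV.Gn n) ∧
          ¬ DKdV.IsTrivial α β DKdV.HRegular (DKdV.Fn n) (DKdV.Gn n)) ∧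
        (∀ (α β : ℝ) (k l : ℤ), ∀ u ∈ DKdV.HRegular,
          DKdV.euler (DKdV.Gn n) α β k l u =
            DKdV.Sk (DKdV.Xseq n).Q α β k l u - DKdV.SkInv (DKdV.Xseq n).Q α β k l u) ∧
        (∀ (α β : ℝ) (k l : ℤ),
          (∃ u ∈ DKdV.HRegular, (DKdV.Xseq n).Q α β k l u ≠ 0) ∧
          (∃ u ∈ DKdV.HRegular, DKdV.euler (DKdV.Gn n) α β k l u ≠ 0))) ∧
      (∀ α β : ℝ, α ≠ β → ∀ c : ℕ →₀ ℝ, c ≠ 0 →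
        ¬ DKdV.IsTrivial α β DKdV.HRegular
            (c.sum fun n a => a • DKdV.Fn n) (c.sum fun n a => a • DKdV.Gn n))) ∧
    -- the vertical line
    ((∀ (n : ℕ),
        DKdV.OnVerticalLine (DKdV.Fbarn n) ∧
        (∀ α β : ℝ, α ≠ β →
          DKdV.IsConservationLaw α β DKdV.VRegular (DKdV.Fbarn n) (DKdV.Gbarn n) ∧
          ¬ DKdV.IsTrivial α β DKdV.VRegular (DKdV.Fbarn n) (DKdV.Gbarn n)) ∧
        (∀ (α β : ℝ) (k l : ℤ), ∀ u ∈ DKdV.VRegular,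
          DKdV.euler (DKdV.Fbarn n) α β k l u =
            -(DKdV.Sl (DKdV.Yseq n).Q α β k l u - DKdV.SlInv (DKdV.Yseq n).Q α β k l u)) ∧
        (∀ (α β : ℝ) (k l : ℤ),
          (∃ u ∈ DKdV.VRegular, (DKdV.Yseq n).Q α β k l u ≠ 0) ∧
          (∃ u ∈ DKdV.VRegular, DKdV.euler (DKdV.Fbarn n) α β k l u ≠ 0))) ∧
      (∀ α β : ℝ, α ≠ β → ∀ c : ℕ →₀ ℝ, c ≠ 0 →
        ¬ DKdV.IsTrivial α β DKdV.VRegular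
            (c.sum fun n a => a • DKdV.Fbarn n) (c.sum fun n a => a • DKdV.Gbarn n))) := by
  open DKdV in
  refine ⟨⟨fun n => ⟨onHorizontalLine_Gn n,
      fun α β hαβ => ⟨isConservationLaw hαβ n, not_isTrivial hαβ n⟩,
      fun α β k l u hu => euler_Gn n α β k l hu,
      fun α β k l => ⟨exists_Xseq_Q_ne_zero n α β k l, exists_euler_Gn_ne_zero n α β k l⟩⟩,
    fun α β hαβ c hc => not_isTrivial_sum hαβ hc⟩, ⟨fun n => ?_, fun α β hαβ c hc => ?_⟩⟩
  · rw [Fbarn_eq, Gbarn_eq, Yseq_eq_swap, euler_neg_swap]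
    refine ⟨fun α β k l => DependsOn.neg (dependsOn_swap (onHorizontalLine_Gn n β α l k)
        fun p hp => hp),
      fun α β hαβ => ⟨(isConservationLaw hαβ.symm n).neg_swap,
        fun h => not_isTrivial hαβ.symm n (isTrivial_of_neg_swap h)⟩,
      fun α β k l u hu => ?_, fun α β k l => ⟨?_, ?_⟩⟩
    · exact congrArg Neg.neg (euler_Gn n β α l k (mem_HRegular_swap.2 hu))
    · obtain ⟨u, hu, h⟩ := exists_Xseq_Q_ne_zero n β α l k
      exact ⟨fun q => u q.swap, mem_VRegular_swap.2 hu, h⟩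
    · obtain ⟨u, hu, h⟩ := exists_euler_Gn_ne_zero n β α l k
      exact ⟨fun q => u q.swap, mem_VRegular_swap.2 hu, neg_ne_zero.2 h⟩
  · simp only [Fbarn_eq, Gbarn_eq, sum_neg_swap]
    exact fun h => not_isTrivial_sum hαβ.symm hc (isTrivial_of_neg_swap h)
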